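/- **Theorem.** Let $\mathbf x=(x_1,x_2,\dots)$, let $h_n(\mathbf x)$ be the complete homogeneous symmetric function of degree $n$ (over $\mathbb R$), and let $H(z)=\sum_{n\ge 0}h_n(\mathbf x)z^n$. Define polynomials $Q_n(\mathbf x,t)$ in $t$ by $$\sum_{n\ge 0}Q_n(\mathbf x,t)\,z^n=\frac{(1-t)H(z)}{H(tz)-tH(z)},$$ and for $n\ge 0$ let $$\tilde Q_n(\mathbf x,t)=h_n(\mathbf x)+t\sum_{m=1}^n h_{n-m}(\mathbf x)\,Q_m(\mathbf x,t).$$ A *skew hook* is a connected skew diagram (English notation, considered up to translation) containing no $2\times 2$ square; for $n=0$ the empty diagram is counted as the unique skew hook of size $0$. Let $\tilde{\mathcal H}_{n,k}$ be the set of skew hooks of size $n$ for which $k$ columns have size $2$ and the remaining $n-2k$ columns have size $1$, and let $$\tilde\gamma_{n,k}(\mathbf x)=\sum_{D\in\tilde{\mathcal H}_{n,k}}s_D(\mathbf x),$$ where $s_D(\mathbf x)$ is the skew Schur function of shape $D$, i.e. the sum of the monomials $\mathbf x^T$ over all semistandard tableaux $T$ of shape $D$ (rows weakly increasing from left to right,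 columns strictly increasing from top to bottom). Then for every $n\ge 0$ $$\tilde Q_n(\mathbf x,t)=\sum_{k=0}^{\lfloor n/2\rfloor}\tilde\gamma_{n,k}(\mathbf x)\,t^k(1+t)^{n-2k}.$$ Consequently $\tilde Q_n(\mathbf x,t)$ is Schur-$\gamma$-positive with center of symmetry $n/2$: there are $\gamma_0,\dots,\gamma_{\lfloor n/2\rfloor}$, each a finite linear combination of Schur functions $s_\lambda(\mathbf x)$ with nonnegative real coefficients, such that $\tilde Q_n(\mathbf x,t)=\sum_{k=0}^{\lfloor n/2\rfloor}\gamma_k\,t^k(1+t)^{n-2k}$. -/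

import Mathlib

namespace BinomialEulerian

/-! ### Symmetric functions as formal power series

The infinitely many variables `x₁, x₂, …` are indexed by `ℕ`: the variable `X i` is `x_{i+1}`, and
accordingly the letters `1, 2, 3, …` filling a tableau are written `0, 1, 2, …`. -/

/-- Formal power series over `ℝ` in the variables `x₁, x₂, …`. -/
abbrev Ser : Type := MvPowerSeries ℕ ℝ

/-- The complete homogeneous symmetric function `h_n`: the sum of all monomials of degree `n`. -/
noncomputable def h (n : ℕ) : Ser := fun m => if m.degree = n then 1 else 0

/-! ### Skew diagrams and skew Schur functions

A cell is a pair `(row, column)`, in English notation as in `YoungDiagram`: rows are numbered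
downwards, columns from left to right. -/

/-- `D` is a skew diagram: the set difference of two nested Young diagrams. -/
def IsSkewDiagram (D : Finset (ℕ × ℕ)) : Prop :=
  ∃ μ ν : YoungDiagram, ν ≤ μ ∧ D = μ.cells \ ν.cells

/-- A semistandard tableau of shape `D`: the entries increase weakly along rows (left to right) and
strictly along columns (top to bottom). -/
structure SkewTableau (D : Finset (ℕ × ℕ)) where
  entry : D → ℕ
  row_weak : ∀ c d : D, c.1.1 = d.1.1 → c.1.2 ≤ d.1.2 → entry c ≤ entry d
  col_strict : ∀ c d : D, c.1.2 = d.1.2 → c.1.1 < d.1.1 → entry c < entry d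

/-- The exponent vector of the monomial `x^T`, the product over all cells `c` of `x_{T(c)}`. -/
noncomputable def SkewTableau.content {D : Finset (ℕ × ℕ)} (T : SkewTableau D) : ℕ →₀ ℕ :=
  ∑ c : D, Finsupp.single (T.entry c) 1

/-- There are finitely many tableaux of a given shape and content, so that the cardinalities in
`skewSchur` are genuine. -/
theorem finite_tableaux (D : Finset (ℕ × ℕ)) (m : ℕ →₀ ℕ) :
    Finite {T : SkewTableau D // T.content = m} := by
  have key : ∀ (T : SkewTableau D), T.content = m → ∀ c, T.entry c ∈ m.support := by
    intro T hT c
    rw [Finsupp.mem_support_iff, ← hT, SkewTableau.content, Finsupp.finsetSum_apply]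
    have : 1 ≤ ∑ d : D, (Finsupp.single (T.entry d) 1 : ℕ →₀ ℕ) (T.entry c) := by
      refine le_trans ?_ (Finset.single_le_sum
        (f := fun d : D => (Finsupp.single (T.entry d) 1 : ℕ →₀ ℕ) (T.entry c))
        (fun _ _ => Nat.zero_le _) (Finset.mem_univ c))
      simp
    omega
  refine Finite.of_injective
    (fun T : {T : SkewTableau D // T.content = m} =>
      (fun c => (⟨T.1.entry c, key T.1 T.2 c⟩ : m.support) : D → m.support)) ?_
  rintro ⟨⟨e, _, _⟩, _⟩ ⟨⟨e', _, _⟩, _⟩ hh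
  have : e = e' := by
    funext c
    exact congrArg Subtype.val (congrFun hh c)
  subst this
  rfl

/-- The skew Schur function `s_D = ∑_T x^T`, the sum over all semistandard tableaux of shape `D`:
the coefficient of a monomial is the number of tableaux with this content. -/
noncomputable def skewSchur (D : Finset (ℕ × ℕ)) : Ser :=
  fun m => (Nat.card {T : SkewTableau D // T.content = m} : ℝ)

/-- The Schur function `s_μ`. -/
noncomputable def schur (μ : YoungDiagram) : Ser := skewSchur μ.cells

/-! ### Skew hooks -/

/-- A skew hook: a connected skew diagram containing no `2 × 2` square. Cells are adjacent when they
share an edge, which is adjacency in the Hasse diagram of `ℕ × ℕ`. The empty diagram is allowed (it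
is the only one of size `0`). -/
def IsSkewHook (D : Finset (ℕ × ℕ)) : Prop :=
  IsSkewDiagram D ∧
  ((SimpleGraph.hasse (ℕ × ℕ)).induce (D : Set (ℕ × ℕ))).Preconnected ∧
  ¬ ∃ i j : ℕ, (i, j) ∈ D ∧ (i + 1, j) ∈ D ∧ (i, j + 1) ∈ D ∧ (i + 1, j + 1) ∈ D

/-- Skew diagrams are considered up to translation. A nonempty diagram is represented by its unique
translate that meets both the first row and the first column. -/
def IsNormalized (D : Finset (ℕ × ℕ)) : Prop :=
  D.Nonempty → (∃ c ∈ D, c.1 = 0) ∧ (∃ c ∈ D, c.2 = 0)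

/-- The indices of the (nonempty) columns of `D`. -/
def columns (D : Finset (ℕ × ℕ)) : Finset ℕ := D.image Prod.snd

/-- The number of cells of `D` in column `j`. -/
def columnSize (D : Finset (ℕ × ℕ)) (j : ℕ) : ℕ := (D.filter fun c => c.2 = j).card

/-- The set of skew hooks of size `n` (up to translation) for which `k` columns have size `2` and
all the remaining columns, `n - 2k` in number, have size `1`. -/
def skewHooks (n k : ℕ) : Set (Finset (ℕ × ℕ)) :=
  {D | IsSkewHook D ∧ IsNormalized D ∧ D.card = n ∧
    (∀ j ∈ columns D, columnSize D j = 1 ∨ columnSize D j = 2) ∧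
    ((columns D).filter fun j => columnSize D j = 2).card = k ∧
    ((columns D).filter fun j => columnSize D j = 1).card = n - 2 * k}

/-- Along a walk, an integer function changing by at most one in each step takes all intermediate
values. -/
theorem exists_eq_of_walk {V : Type*} {G : SimpleGraph V} (f : V → ℕ)
    (hf : ∀ a b, G.Adj a b → f b ≤ f a + 1) {u v : V} (p : G.Walk u v) (m : ℕ)
    (hu : f u ≤ m) (hv : m ≤ f v) : ∃ w, f w = m := by
  induction p with
  | nil => exact ⟨_, le_antisymm hu hv⟩
  | cons hadj p ih =>
    rcases Nat.eq_or_lt_of_le hu with e | e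
    · exact ⟨_, e⟩
    · exact ih ((hf _ _ hadj).trans e) hv

theorem lt_card_of_connected {D : Finset (ℕ × ℕ)}
    (hD : ((SimpleGraph.hasse (ℕ × ℕ)).induce (D : Set (ℕ × ℕ))).Preconnected)
    (f : ℕ × ℕ → ℕ) (hf : ∀ a b : ℕ × ℕ, a ⋖ b ∨ b ⋖ a → f b ≤ f a + 1)
    (h0 : ∃ c ∈ D, f c = 0) {d : ℕ × ℕ} (hd : d ∈ D) : f d < D.card := by
  obtain ⟨c, hc, hc0⟩ := h0
  obtain ⟨p⟩ := hD ⟨c, hc⟩ ⟨d, hd⟩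
  have hsub : Finset.range (f d + 1) ⊆ D.image f := by
    intro m hm
    obtain ⟨w, hw⟩ := exists_eq_of_walk (fun a : ((D : Set (ℕ × ℕ)) : Type) => f a.1)
      (fun a b hab => hf _ _ hab) p m (by simp [hc0])
      (Nat.lt_succ_iff.mp (Finset.mem_range.mp hm))
    exact Finset.mem_image.mpr ⟨w.1, w.2, hw⟩
  have := (Finset.card_le_card hsub).trans Finset.card_image_le
  simpa using this

theorem finite_skewHooks (n k : ℕ) : (skewHooks n k).Finite := by
  refine Set.Finite.subset ((Finset.range n ×ˢ Finset.range n).powerset.finite_toSet) ?_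
  rintro D ⟨⟨-, hconn, -⟩, hnorm, hcard, -⟩
  rw [Finset.mem_coe, Finset.mem_powerset]
  intro d hd
  obtain ⟨hr, hc⟩ := hnorm ⟨d, hd⟩
  have h1 := lt_card_of_connected hconn Prod.fst (by
    intro a b hab
    simp only [Prod.covBy_iff, Nat.covBy_iff_add_one_eq] at hab
    omega) hr hd
  have h2 := lt_card_of_connected hconn Prod.snd (by
    intro a b hab
    simp only [Prod.covBy_iff, Nat.covBy_iff_add_one_eq] at hab
    omega) hc hd
  rw [hcard] at h1 h2
  exact Finset.mem_product.mpr ⟨Finset.mem_range.mpr h1, Finset.mem_range.mpr h2⟩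

/-- `γ̃_{n,k}`, the sum of the skew Schur functions `s_D` over all `D` in `skewHooks n k`. -/
noncomputable def gammaTilde (n k : ℕ) : Ser :=
  ∑ D ∈ (finite_skewHooks n k).toFinset, skewSchur D

/-! ### The polynomials `Q_n` and `Q̃_n`

These are polynomials in `t = Polynomial.X` over `Ser`; `z` is the variable of `PowerSeries`. -/

/-- The generating function `H(z) = ∑_{n ≥ 0} h_n z^n`. -/
noncomputable def H : PowerSeries (Polynomial Ser) := PowerSeries.mk fun n => Polynomial.C (h n)

/-- `H(tz)`. -/
noncomputable def Ht : PowerSeries (Polynomial Ser) := PowerSeries.rescale Polynomial.X H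

theorem h_zero : h 0 = 1 := by
  classical
  ext m
  rw [MvPowerSeries.coeff_one]
  change (if m.degree = 0 then (1 : ℝ) else 0) = _
  simp [Finsupp.degree_eq_zero_iff]

theorem denominator_eq :
    Ht - PowerSeries.C Polynomial.X * H =
      PowerSeries.C (1 - Polynomial.X) * PowerSeries.mk (fun n => if n = 0 then 1 else
        -(Polynomial.X * (∑ i ∈ Finset.range (n - 1), Polynomial.X ^ i) * Polynomial.C (h n))) := by
  ext1 n
  rw [Ht, map_sub, PowerSeries.coeff_rescale, PowerSeries.coeff_C_mul, PowerSeries.coeff_C_mul, H,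
    PowerSeries.coeff_mk, PowerSeries.coeff_mk]
  rcases n with _ | n
  · simp [h_zero]
  · have hg := mul_neg_geom_sum (Polynomial.X : Polynomial Ser) n
    rw [if_neg (Nat.succ_ne_zero n), Nat.add_sub_cancel]
    linear_combination Polynomial.X * Polynomial.C (h (n + 1)) * hg

/-- There is exactly one power series in `z`, with coefficients polynomial in `t`, that equals the
quotient `(1 - t) H(z) / (H(tz) - t H(z))`. -/
theorem existsUnique_Q : ∃! G : PowerSeries (Polynomial Ser),
    G * (Ht - PowerSeries.C Polynomial.X * H) = PowerSeries.C (1 - Polynomial.X) * H := by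
  rw [denominator_eq]
  set E : PowerSeries (Polynomial Ser) := PowerSeries.mk (fun n => if n = 0 then 1 else
    -(Polynomial.X * (∑ i ∈ Finset.range (n - 1), Polynomial.X ^ i) * Polynomial.C (h n))) with hE
  have hE0 : PowerSeries.constantCoeff E = ((1 : (Polynomial Ser)ˣ) : Polynomial Ser) := by
    simp [hE]
  have hinv := PowerSeries.mul_invOfUnit E 1 hE0
  have hX : (1 - Polynomial.X : Polynomial Ser) ≠ 0 := by
    intro hh
    have := congrArg (fun p => Polynomial.coeff p 0) hh
    simp at this
  refine ⟨H * PowerSeries.invOfUnit E 1, ?_, ?_⟩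
  · linear_combination PowerSeries.C (1 - Polynomial.X) * H * hinv
  · intro G hG
    have hC : (PowerSeries.C (1 - Polynomial.X : Polynomial Ser)) ≠ 0 := by
      intro hh
      exact hX (by simpa using congrArg PowerSeries.constantCoeff hh)
    have hGE : G * E = H := mul_left_cancel₀ hC (by linear_combination hG)
    linear_combination PowerSeries.invOfUnit E 1 * hGE - G * hinv

/-- `Q_n(x,t)`, the coefficient of `z^n` in `(1 - t) H(z) / (H(tz) - t H(z))`. -/
noncomputable def Q (n : ℕ) : Polynomial Ser := PowerSeries.coeff n existsUnique_Q.choose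

/-- `Q̃_n(x,t) = h_n + t ∑_{m=1}^n h_{n-m} Q_m(x,t)`. -/
noncomputable def QTilde (n : ℕ) : Polynomial Ser :=
  Polynomial.C (h n) +
    Polynomial.X * ∑ m ∈ Finset.Icc 1 n, Polynomial.C (h (n - m)) * Q m

/-! ### Schur-γ-positivity -/

/-- Schur-positive: a (finite) linear combination of Schur functions with nonnegative real
coefficients. -/
def IsSchurPositive (f : Ser) : Prop :=
  ∃ c : YoungDiagram →₀ ℝ, (∀ μ, 0 ≤ c μ) ∧ f = c.sum fun μ a => a • schur μ

/-- `A(t)` is Schur-γ-positive, with center of symmetry `d / 2`. -/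
def IsSchurGammaPositive (d : ℕ) (A : Polynomial Ser) : Prop :=
  ∃ γ : ℕ → Ser, (∀ k ∈ Finset.range (d / 2 + 1), IsSchurPositive (γ k)) ∧
    A = ∑ k ∈ Finset.range (d / 2 + 1),
      Polynomial.C (γ k) * Polynomial.X ^ k * (1 + Polynomial.X) ^ (d - 2 * k)

end BinomialEulerian

/-! Let `E(z) = ∑ (-1)^n e_n z^n = 1 / H(z)`. The definitions give `∑ Q̃_n z^n = (1 - t) H(z) H(tz)
/ (H(tz) - t H(z))`, whose reciprocal is `(E(z) - t E(tz)) / (1 - t) = ∑ a_n e_n z^n` with `a_n =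
(-1)^n (1 + t + ... + t^n)`. Since `∑ a_n z^n = 1 / (1 + (1 + t) z + t z^2)`, the run theorem
(`increasing_mul_runWeights`) inverts the series. The coefficient of `z^n` is a sum over words of
length `n`, with a factor `1 + t` for each maximal strictly increasing run of length 1 and `t` for
each run of length 2; words with longer runs do not count (`evalAt_QTilde`).

Such a word has no two consecutive strict ascents, and with `k` ascents its weight is `t^k (1 +
t)^(n - 2k)`. Reading a ribbon from its top right to its bottom left end turns columns into
increasing runs, so the words with a prescribed ascent set sum to a ribbon Schur function
(`skewSchur_ribbon`). Every skew hook is a ribbon (`exists_eq_ribbon`), and columns of size at most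
2 correspond to the absence of consecutive ascents. This yields the expansion (`QTilde_eq_sum`).

For Schur positivity, words are inserted by RSK. The recording tableau determines the ascent set
(`descSet_recording`), and the words with a fixed recording tableau correspond, with content
preserved, to all semistandard tableaux of one shape (`card_recording_eq`, `card_tableaux_eq`).
Hence any sum of words selected by a condition on ascent sets is a sum of Schur functions
(`isSchurPositive_wordSum`). -/

namespace BinomialEulerian

open Finset

/-! ### Sums over words -/

/-- The words with content `m`, that is, in which the letter `i` occurs `m i` times. -/
noncomputable def words (m : ℕ →₀ ℕ) : Finset (List ℕ) := (Finsupp.toMultiset m).lists.toFinset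

/-- The content of a word. -/
noncomputable def wordContent (l : List ℕ) : ℕ →₀ ℕ := Multiset.toFinsupp (l : Multiset ℕ)

theorem mem_words {m : ℕ →₀ ℕ} {l : List ℕ} : l ∈ words m ↔ wordContent l = m := by
  rw [words, Multiset.mem_toFinset, Multiset.mem_lists_iff, wordContent]
  constructor
  · intro hh
    change _ = (l : Multiset ℕ) at hh
    rw [← hh, Finsupp.toMultiset_toFinsupp]
  · rintro rfl
    rw [Multiset.toFinsupp_toMultiset]
    rfl

/-- The sum of `f w • x^w` over all words `w` of length `n`. -/
noncomputable def wordSum (n : ℕ) (f : List ℕ → ℝ) : Ser := fun m =>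
  ∑ l ∈ words m with l.length = n, f l

theorem coeff_wordSum (n : ℕ) (f : List ℕ → ℝ) (m : ℕ →₀ ℕ) :
    MvPowerSeries.coeff m (wordSum n f) =
      ∑ l ∈ words m with l.length = n, f l := rfl

theorem wordSum_congr {n : ℕ} {f g : List ℕ → ℝ} (hfg : ∀ l, l.length = n → f l = g l) :
    wordSum n f = wordSum n g := by
  ext m
  rw [coeff_wordSum, coeff_wordSum]
  exact Finset.sum_congr rfl fun l hl => hfg l (Finset.mem_filter.mp hl).2

theorem wordSum_sum {ι : Type*} (s : Finset ι) (n : ℕ) (f : ι → List ℕ → ℝ) :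
    wordSum n (fun l => ∑ i ∈ s, f i l) = ∑ i ∈ s, wordSum n (f i) := by
  ext m
  rw [map_sum]
  simp only [coeff_wordSum]
  exact Finset.sum_comm

theorem wordSum_smul (n : ℕ) (c : ℝ) (f : List ℕ → ℝ) :
    wordSum n (fun l => c * f l) = c • wordSum n f := by
  ext m
  rw [MvPowerSeries.coeff_smul]
  simp only [coeff_wordSum, Finset.mul_sum]

theorem wordSum_zero_fun (n : ℕ) : wordSum n (fun _ => 0) = 0 := by
  ext m
  simp [coeff_wordSum]

/-- A word of length `i + j` has a unique cut after its `i`-th letter, and contents add under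
concatenation. -/
theorem wordSum_mul (i j : ℕ) (f g : List ℕ → ℝ) :
    wordSum i f * wordSum j g = wordSum (i + j) (fun l => f (l.take i) * g (l.drop i)) := by
  ext m
  rw [MvPowerSeries.coeff_mul]
  simp only [coeff_wordSum, Finset.sum_mul_sum]
  simp only [← Finset.sum_product']
  rw [Finset.sum_sigma']
  refine Finset.sum_bij' (fun a _ => a.2.1 ++ a.2.2)
    (fun l _ => ⟨(wordContent (l.take i),
      wordContent (l.drop i)), (l.take i, l.drop i)⟩) ?_ ?_ ?_ ?_ ?_
  · rintro ⟨⟨p, q⟩, u, v⟩ hh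
    simp only [mem_sigma, HasAntidiagonal.mem_antidiagonal, mem_product, mem_filter, mem_words] at hh ⊢
    obtain ⟨rfl, ⟨rfl, rfl⟩, rfl, rfl⟩ := hh
    simp [wordContent, ← Multiset.coe_add]
  · intro l hh
    simp only [mem_sigma, HasAntidiagonal.mem_antidiagonal, mem_product, mem_filter, mem_words] at hh ⊢
    obtain ⟨rfl, hl⟩ := hh
    refine ⟨?_, ⟨trivial, ?_⟩, trivial, ?_⟩
    · rw [wordContent, wordContent, wordContent, ← map_add, Multiset.coe_add, List.take_append_drop]
    · simp [hl]
    · simp [hl]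
  · rintro ⟨⟨p, q⟩, u, v⟩ hh
    simp only [mem_sigma, HasAntidiagonal.mem_antidiagonal, mem_product, mem_filter, mem_words] at hh
    obtain ⟨rfl, ⟨rfl, rfl⟩, rfl, rfl⟩ := hh
    simp
  · intro l hh
    simp
  · rintro ⟨⟨p, q⟩, u, v⟩ hh
    simp only [mem_sigma, HasAntidiagonal.mem_antidiagonal, mem_product, mem_filter, mem_words] at hh
    obtain ⟨rfl, ⟨rfl, rfl⟩, rfl, rfl⟩ := hh
    simp

theorem wordSum_zero (f : List ℕ → ℝ) : wordSum 0 f = MvPowerSeries.C (f []) := by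
  classical
  ext m
  rw [coeff_wordSum, MvPowerSeries.coeff_C]
  by_cases hm : m = 0
  · subst hm
    rw [if_pos rfl, Finset.sum_eq_single []]
    · intro l hl hne
      simp only [mem_filter, List.length_eq_zero_iff] at hl
      exact absurd hl.2 hne
    · intro hh
      simp [mem_words, wordContent] at hh
  · rw [if_neg hm]
    refine Finset.sum_eq_zero fun l hl => ?_
    simp only [mem_filter, List.length_eq_zero_iff, mem_words] at hl
    obtain ⟨h1, rfl⟩ := hl
    exact absurd (by simpa [wordContent] using h1.symm) hm

/-! ### Words weighted by their maximal strictly increasing runs -/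

/-- The first component is the product, over the maximal strictly increasing runs of the word, of
`p` for a run of length `1`, of `q` for a run of length `2`, and of `0` for longer runs. The second
component is the product over all runs but the first when the first run has length `1`, and `0`
otherwise. -/
noncomputable def runWeights (p q : ℝ) : List ℕ → ℝ × ℝ
  | [] => (1, 0)
  | [_] => (p, 1)
  | x :: y :: l => if x < y then (q * (runWeights p q (y :: l)).2, 0)
      else (p * (runWeights p q (y :: l)).1, (runWeights p q (y :: l)).1)

/-- The indicator function of strictly increasing words. -/
noncomputable def increasing (l : List ℕ) : ℝ :=
  open Classical in if l.IsChain (· < ·) then 1 else 0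

/-- Only prefixes inside the first run contribute. The shift `i` is what lets the induction remove
the first letter. For `i = 0` the right side vanishes as soon as `a 1 = -p * a 0`, which is the use
made of it. -/
theorem sum_increasing_runWeights {p q : ℝ} {a : ℕ → ℝ}
    (ha : ∀ m, a (m + 2) = -p * a (m + 1) - q * a m) (x : ℕ) (l : List ℕ) (i : ℕ) :
    ∑ m ∈ range (l.length + 2), a (m + i) * (increasing ((x :: l).take m) *
      (runWeights p q ((x :: l).drop m)).1) =
    (a (i + 1) + p * a i) * (runWeights p q (x :: l)).2 := by
  induction l generalizing x i with
  | nil =>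
    simp [Finset.sum_range_succ, runWeights, increasing, Nat.add_comm 1 i]
    ring
  | cons y l ih =>
    rw [Finset.sum_range_succ']
    -- If the first run continues, the term `m = 0` supplies `q * a i`, and the recurrence cancels
    -- it against the induction hypothesis at `i + 1`. Otherwise only `m = 0` and `m = 1` survive.
    by_cases hxy : x < y
    · have key : ∀ m, increasing ((x :: y :: l).take (m + 1)) = increasing ((y :: l).take m) := by
        intro m
        rw [increasing, increasing]
        congr 1
        cases m <;> simp [hxy]
      have := ih y (i + 1)
      simp only [key, List.drop_succ_cons, List.length_cons]
      simp only [← add_assoc, add_right_comm _ i 1] at this ⊢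
      rw [this, ha]
      simp [runWeights, hxy, increasing]
      ring
    · have key : ∀ m, increasing ((x :: y :: l).take (m + 1)) = if m = 0 then 1 else 0 := by
        intro m
        cases m <;> simp [increasing, hxy]
      simp only [key, List.drop_succ_cons]
      rw [Finset.sum_eq_single 0]
      · simp [runWeights, hxy, increasing, Nat.add_comm 1 i]
        ring
      · intro b _ hb
        simp [hb]
      · simp

/-- The run theorem: the hypotheses say that `∑ a_m z^m = 1 / (1 + p z + q z^2)`, and the
denominator records the weights of runs. The coefficient of the product at a nonempty word is an
alternating sum over its increasing prefixes, which cancels. -/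
theorem increasing_mul_runWeights {p q : ℝ} {a : ℕ → ℝ} (a0 : a 0 = 1) (a1 : a 1 = -p)
    (ha : ∀ m, a (m + 2) = -p * a (m + 1) - q * a m) :
    PowerSeries.mk (fun n => a n • wordSum n increasing) *
      PowerSeries.mk (fun n => wordSum n fun l => (runWeights p q l).1) = 1 := by
  ext1 n
  rw [PowerSeries.coeff_mul, PowerSeries.coeff_one]
  simp only [PowerSeries.coeff_mk]
  rw [Finset.Nat.sum_antidiagonal_eq_sum_range_succ
    (fun i j => a i • wordSum i increasing * wordSum j fun l => (runWeights p q l).1)]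
  have : ∀ k ∈ range n.succ, a k • wordSum k increasing *
      wordSum (n - k) (fun l => (runWeights p q l).1) =
      wordSum n (fun l => a k * (increasing (l.take k) * (runWeights p q (l.drop k)).1)) := by
    intro k hk
    rw [wordSum_smul, smul_mul_assoc, wordSum_mul,
      Nat.add_sub_cancel' (Nat.lt_succ_iff.mp (Finset.mem_range.mp hk))]
  rw [Finset.sum_congr rfl this, ← wordSum_sum]
  rcases n with _ | n
  · rw [wordSum_zero]
    simp [runWeights, increasing, a0]
  · rw [if_neg (Nat.succ_ne_zero n), ← wordSum_zero_fun (n + 1)]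
    refine wordSum_congr fun l hl => ?_
    rcases l with _ | ⟨x, l⟩
    · simp at hl
    · clear this
      have := sum_increasing_runWeights ha x l 0
      simp only [List.length_cons, Nat.add_right_cancel_iff] at hl
      subst hl
      simp only [Nat.succ_eq_add_one, add_zero] at this ⊢
      simp only [this]
      rw [zero_add, a0, a1]
      ring

theorem runWeights_one_zero (l : List ℕ) :
    (runWeights 1 0 l).1 = open Classical in if l.IsChain (· ≥ ·) then 1 else 0 := by
  induction l with
  | nil => simp [runWeights]
  | cons x l ih =>
    rcases l with _ | ⟨y, l⟩
    · simp [runWeights]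
    · by_cases hxy : x < y
      · simp [runWeights, hxy]
      · simp only [runWeights, if_neg hxy, one_mul, ih, List.isChain_cons_cons]
        simp [not_lt.mp hxy]

theorem length_eq_degree {l : List ℕ} {m : ℕ →₀ ℕ} (hl : wordContent l = m) :
    l.length = m.degree := by
  rw [← hl, Finsupp.degree_apply]
  have := Finsupp.card_toMultiset (wordContent l)
  rw [wordContent, Multiset.toFinsupp_toMultiset, Multiset.coe_card] at this
  exact this

/-- The weights `1, 0` select weakly decreasing words, and each multiset of letters has exactly one
such arrangement. Thus `H` also falls under the run theorem, which then gives `E(z) H(z) = 1`. -/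
theorem h_eq_wordSum (n : ℕ) : h n = wordSum n fun l => (runWeights 1 0 l).1 := by
  classical
  ext m
  rw [coeff_wordSum]
  change (if m.degree = n then (1 : ℝ) else 0) = _
  simp only [runWeights_one_zero]
  set s := (Finsupp.toMultiset m).sort (· ≥ ·) with hs
  have hsm : wordContent s = m := by
    rw [wordContent, hs, Multiset.sort_eq, Finsupp.toMultiset_toFinsupp]
  have hsp : s.Pairwise (· ≥ ·) := Multiset.pairwise_sort _ _
  split_ifs with hm
  · rw [Finset.sum_eq_single s]
    · rw [if_pos hsp.isChain]
    · intro l hl hne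
      rw [if_neg]
      intro hch
      refine hne (List.Perm.eq_of_pairwise (fun a b _ _ h1 h2 => le_antisymm h2 h1)
        hch.pairwise hsp ?_)
      rw [← Multiset.coe_eq_coe]
      apply Multiset.toFinsupp.injective
      exact (mem_words.mp (Finset.mem_filter.mp hl).1).trans hsm.symm
    · intro hh
      exact absurd (Finset.mem_filter.mpr ⟨mem_words.mpr hsm,
        (length_eq_degree hsm).trans hm⟩) hh
  · symm
    refine Finset.sum_eq_zero fun l hl => absurd ?_ hm
    obtain ⟨h1, h2⟩ := Finset.mem_filter.mp hl
    rw [← h2, length_eq_degree (mem_words.mp h1)]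

/-! ### The generating function of `Q̃_n` -/

/-- Evaluation of the polynomials in `t` at a real number. -/
noncomputable def evalAt (t : ℝ) : Polynomial Ser →+* Ser :=
  Polynomial.evalRingHom (MvPowerSeries.C t)

theorem smul_eq_C_mul (t : ℝ) (f : Ser) : t • f = MvPowerSeries.C t * f :=
  MvPowerSeries.smul_eq_C_mul f t

theorem map_evalAt_H (t : ℝ) : PowerSeries.map (evalAt t) H = PowerSeries.mk h := by
  ext1 n
  simp [H, evalAt]

theorem map_evalAt_Ht (t : ℝ) :
    PowerSeries.map (evalAt t) Ht = PowerSeries.rescale (MvPowerSeries.C t) (PowerSeries.mk h) := by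
  ext1 n
  simp [Ht, H, evalAt, PowerSeries.coeff_rescale]
  exact mul_comm _ _

theorem Q_spec : PowerSeries.mk Q * (Ht - PowerSeries.C Polynomial.X * H) =
    PowerSeries.C (1 - Polynomial.X) * H := by
  have : PowerSeries.mk Q = existsUnique_Q.choose := by
    ext1 n
    simp [Q]
  rw [this]
  exact existsUnique_Q.choose_spec.1

theorem Q_zero : Q 0 = 1 := by
  have := Q_spec
  rw [mul_comm] at this
  have := congrArg (PowerSeries.coeff 0) this
  have hX : (1 - Polynomial.X : Polynomial Ser) ≠ 0 := by
    intro hh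
    have := congrArg (fun p => Polynomial.coeff p 0) hh
    simp at this
  simp only [map_sub, Ht, H,
    PowerSeries.coeff_zero_eq_constantCoeff, map_mul, PowerSeries.constantCoeff_C, map_one] at this
  simp only [← PowerSeries.coeff_zero_eq_constantCoeff, PowerSeries.coeff_mk,
    PowerSeries.coeff_rescale, h_zero, pow_zero, mul_one, map_one] at this
  exact mul_left_cancel₀ hX (by rw [this, mul_one])

theorem mk_QTilde : PowerSeries.mk QTilde =
    H + PowerSeries.C Polynomial.X * (H * PowerSeries.mk Q - H) := by
  ext1 n
  rw [map_add, PowerSeries.coeff_C_mul, map_sub, PowerSeries.coeff_mk, mul_comm H,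
    PowerSeries.coeff_mul, Finset.Nat.sum_antidiagonal_eq_sum_range_succ
      (fun i j => PowerSeries.coeff i (PowerSeries.mk Q) * PowerSeries.coeff j H),
    Finset.range_eq_Ico, Finset.sum_eq_sum_Ico_succ_bot (Nat.succ_pos n)]
  simp only [H, PowerSeries.coeff_mk, Q_zero, QTilde, one_mul, Nat.sub_zero, add_sub_cancel_left]
  -- As `Q 0 = 1`, subtracting `H` has removed exactly the summand `m = 0`.
  congr 2
  refine Finset.sum_congr ?_ fun m _ => mul_comm _ _
  exact (Finset.Ico_succ_right_eq_Icc 1 n).symm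

theorem mk_QTilde_mul : PowerSeries.mk QTilde * (Ht - PowerSeries.C Polynomial.X * H) =
    PowerSeries.C (1 - Polynomial.X) * (H * Ht) := by
  have := Q_spec
  rw [mk_QTilde, map_sub, map_one] at *
  linear_combination (PowerSeries.C Polynomial.X) * H * this

/-- The coefficients of `1 / ((1 + z) (1 + t z))`. -/
noncomputable def geomCoeff (t : ℝ) (m : ℕ) : ℝ := (-1) ^ m * ∑ i ∈ range (m + 1), t ^ i

/-- Evaluating at a real `t` keeps the word weights real. The value `t = 1` is excluded because the
denominator `H(tz) - t H(z)` has constant term `1 - t` and must be cancelled. -/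
theorem evalAt_QTilde {t : ℝ} (ht : t ≠ 1) (n : ℕ) :
    evalAt t (QTilde n) = wordSum n fun l => (runWeights (1 + t) t l).1 := by
  set Hs : PowerSeries Ser := PowerSeries.mk h with hHs
  set Ts : PowerSeries Ser := PowerSeries.rescale (MvPowerSeries.C t) Hs with hTs
  set E : PowerSeries Ser := PowerSeries.mk fun n => (-1 : ℝ) ^ n • wordSum n increasing with hE
  set Et : PowerSeries Ser := PowerSeries.rescale (MvPowerSeries.C t) E with hEt
  set A : PowerSeries Ser := PowerSeries.mk fun n => geomCoeff t n • wordSum n increasing with hA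
  set G : PowerSeries Ser :=
    PowerSeries.mk (fun n => wordSum n fun l => (runWeights (1 + t) t l).1) with hG
  set c : PowerSeries Ser := PowerSeries.C (MvPowerSeries.C t) with hc
  have h1 : E * Hs = 1 := by
    rw [hHs, show h = (fun n => wordSum n fun l => (runWeights 1 0 l).1) from funext h_eq_wordSum]
    refine increasing_mul_runWeights (pow_zero _) (pow_one _) fun m => ?_
    ring
  have h2 : Et * Ts = 1 := by rw [hEt, hTs, ← map_mul, h1, map_one]
  have h3 : A * G = 1 := by
    refine increasing_mul_runWeights ?_ ?_ fun m => ?_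
    · simp [geomCoeff]
    · simp [geomCoeff, Finset.sum_range_succ]
    · simp only [geomCoeff]
      rw [Finset.sum_range_succ _ (m + 2), Finset.sum_range_succ _ (m + 1)]
      ring
  have h4 : (1 - c) * A = E - c * Et := by
    ext1 n
    rw [sub_mul, one_mul, hc, map_sub, map_sub, PowerSeries.coeff_C_mul, PowerSeries.coeff_C_mul,
      hEt, PowerSeries.coeff_rescale, hA, hE, PowerSeries.coeff_mk, PowerSeries.coeff_mk]
    simp only [smul_eq_C_mul, geomCoeff, ← mul_assoc, ← map_pow, ← map_mul, ← sub_mul, ← map_sub]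
    congr 2
    have := mul_neg_geom_sum t (n + 1)
    linear_combination (-1) ^ n * this
  have h5 := congrArg (PowerSeries.map (evalAt t)) mk_QTilde_mul
  rw [map_mul, map_sub, map_mul, map_mul, map_mul, map_evalAt_H, map_evalAt_Ht, PowerSeries.map_C,
    PowerSeries.map_C, ← hHs, ← hTs, map_sub, map_one] at h5
  have hX : evalAt t Polynomial.X = MvPowerSeries.C t := by simp [evalAt]
  rw [hX, map_sub, map_one, ← hc] at h5
  have hne : Ts - c * Hs ≠ 0 := by
    intro hh
    have := congrArg (fun f => MvPowerSeries.constantCoeff (PowerSeries.coeff 0 f)) hh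
    simp only [hTs, hHs, hc, map_sub, PowerSeries.coeff_C_mul, PowerSeries.coeff_mk,
      PowerSeries.coeff_rescale, h_zero, pow_zero, mul_one, map_one, map_zero,
      MvPowerSeries.constantCoeff_C] at this
    exact ht (sub_eq_zero.mp this).symm
  have h6 : PowerSeries.map (evalAt t) (PowerSeries.mk QTilde) = G := by
    refine mul_right_cancel₀ hne ?_
    rw [h5]
    -- Multiplying `(1 - c) * A = E - c * Et` by `G * Hs * Ts` and using the three inverse pairs
    -- gives `(1 - c) * Hs * Ts = G * (Ts - c * Hs)`.
    linear_combination (1 - c) * Hs * Ts * (-h3) + G * Hs * Ts * h4 + G * Ts * h1 - c * G * Hs * h2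
  have := congrArg (PowerSeries.coeff n) h6
  simpa [hG] using this

/-- Over the domain `Ser`, a polynomial identity may be checked at infinitely many constants. -/
theorem eq_of_evalAt {p q : Polynomial Ser} (hpq : ∀ t : ℝ, t ≠ 1 → evalAt t p = evalAt t q) :
    p = q := by
  have : IsDomain Ser := NoZeroDivisors.to_isDomain _
  refine Polynomial.eq_of_infinite_eval_eq p q ?_
  have hinj : Function.Injective (MvPowerSeries.C : ℝ →+* Ser) := RingHom.injective _
  refine Set.Infinite.mono ?_ (((Set.finite_singleton (1 : ℝ)).infinite_compl).image hinj.injOn)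
  rintro _ ⟨t, ht, rfl⟩
  exact hpq t ht

/-! ### Strict ascents -/

/-- The set of strict ascents of a word. -/
def ascSet (l : List ℕ) : Finset ℕ :=
  (range (l.length - 1)).filter fun i => l.getD i 0 < l.getD (i + 1) 0

theorem mem_ascSet {l : List ℕ} {i : ℕ} :
    i ∈ ascSet l ↔ i + 1 < l.length ∧ l.getD i 0 < l.getD (i + 1) 0 := by
  simp only [ascSet, mem_filter, mem_range]
  omega

theorem ascSet_subset (l : List ℕ) : ascSet l ⊆ range (l.length - 1) := filter_subset _ _

/-- No two elements of the set are consecutive. -/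
def NoConsec (S : Finset ℕ) : Prop := ∀ i ∈ S, i + 1 ∉ S

theorem succ_mem_ascSet_cons {x i : ℕ} {l : List ℕ} : i + 1 ∈ ascSet (x :: l) ↔ i ∈ ascSet l := by
  simp [mem_ascSet]

theorem card_ascSet_cons (x : ℕ) (l : List ℕ) :
    (ascSet (x :: l)).card = (if 0 ∈ ascSet (x :: l) then 1 else 0) + (ascSet l).card := by
  have himg : ((ascSet l).image Nat.succ).card = (ascSet l).card :=
    card_image_of_injective _ Nat.succ_injective
  split_ifs with h0
  · have : ascSet (x :: l) = insert 0 ((ascSet l).image Nat.succ) := by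
      ext i
      rcases i with _ | i
      · simpa using h0
      · simp [succ_mem_ascSet_cons]
    rw [this, card_insert_of_notMem (by simp), himg, add_comm]
  · have : ascSet (x :: l) = (ascSet l).image Nat.succ := by
      ext i
      rcases i with _ | i
      · simpa using h0
      · simp [succ_mem_ascSet_cons]
    rw [this, himg, zero_add]

theorem noConsec_ascSet_cons {x : ℕ} {l : List ℕ} :
    NoConsec (ascSet (x :: l)) ↔
      NoConsec (ascSet l) ∧ ¬ (0 ∈ ascSet (x :: l) ∧ 0 ∈ ascSet l) := by
  constructor
  · intro hh
    refine ⟨fun i hi hi' => hh (i + 1) (succ_mem_ascSet_cons.mpr hi)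
      (succ_mem_ascSet_cons.mpr hi'), fun ⟨h0, h1⟩ => hh 0 h0 (succ_mem_ascSet_cons.mpr h1)⟩
  · rintro ⟨h1, h2⟩ i hi hi'
    rw [succ_mem_ascSet_cons] at hi'
    rcases i with _ | i
    · exact h2 ⟨hi, hi'⟩
    · exact h1 i (succ_mem_ascSet_cons.mp hi) hi'

/-- `S` and its translate by one are disjoint subsets of `range n`. -/
theorem two_mul_card_le {S : Finset ℕ} {n : ℕ} (hS : S ⊆ range (n - 1)) (hc : NoConsec S) :
    2 * S.card ≤ n := by
  have hd : Disjoint S (S.image Nat.succ) := by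
    rw [Finset.disjoint_left]
    rintro a ha hb
    obtain ⟨b, hb', rfl⟩ := mem_image.mp hb
    exact hc b hb' ha
  have hsub : S ∪ S.image Nat.succ ⊆ range n := by
    intro a ha
    rw [mem_range]
    rcases mem_union.mp ha with ha | ha
    · have := mem_range.mp (hS ha)
      omega
    · obtain ⟨b, hb, rfl⟩ := mem_image.mp ha
      have := mem_range.mp (hS hb)
      omega
  have := card_le_card hsub
  rw [card_union_of_disjoint hd, card_image_of_injective _ Nat.succ_injective, card_range] at this
  omega

/-- The weight of a word in terms of its set of strict ascents. -/
noncomputable def ascWeight (p q : ℝ) (l : List ℕ) : ℝ :=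
  open Classical in if NoConsec (ascSet l) then
    q ^ (ascSet l).card * p ^ (l.length - 2 * (ascSet l).card) else 0

/-- A run of length at least 3 is a pair of consecutive ascents; otherwise ascents correspond to
runs of length 2, and the remaining `n - 2k` letters are runs of length 1. The recursion for
`runWeights` forces both components to be treated together. -/
theorem runWeights_eq (p q : ℝ) (l : List ℕ) :
    (runWeights p q l).1 = ascWeight p q l ∧
    ∀ x l', l = x :: l' → (runWeights p q l).2 = if 0 ∈ ascSet l then 0 else ascWeight p q l' := by
  classical
  induction l with
  | nil => simp [runWeights, ascWeight, ascSet, NoConsec]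
  | cons x l ih =>
    obtain ⟨ih1, ih2⟩ := ih
    rcases l with _ | ⟨y, l⟩
    · simp [runWeights, ascWeight, ascSet, NoConsec]
    · have hxy : 0 ∈ ascSet (x :: y :: l) ↔ x < y := by simp [mem_ascSet]
      have h2 := ih2 y l rfl
      have hle : NoConsec (ascSet (y :: l)) → 2 * (ascSet (y :: l)).card ≤ (y :: l).length :=
        two_mul_card_le (ascSet_subset _)
      have hcd := card_ascSet_cons x (y :: l)
      refine ⟨?_, ?_⟩
      · rw [ascWeight, noConsec_ascSet_cons, hcd]
        by_cases hlt : x < y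
        · rw [runWeights, if_pos hlt]
          simp only [hxy, hlt, if_true, true_and]
          by_cases h0 : 0 ∈ ascSet (y :: l)
          · simp [h2, h0]
          · have e2 := noConsec_ascSet_cons (x := y) (l := l)
            have e3 := card_ascSet_cons y l
            rw [if_neg h0, zero_add] at e3
            simp only [h0, false_and, not_false_eq_true, and_true] at e2
            simp only [h0, not_false_eq_true, and_true, e2, h2, if_false, ascWeight, e3]
            split_ifs
            · rw [pow_add, pow_one, mul_assoc]
              congr 3
              simp only [List.length_cons]
              omega
            · simp
        · rw [runWeights, if_neg hlt, ih1, ascWeight]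
          simp only [hxy, hlt, if_false, false_and, not_false_eq_true, and_true, zero_add]
          split_ifs with hc
          · have := hle hc
            rw [List.length_cons (a := x), Nat.sub_add_comm this, pow_succ]
            ring
          · simp
      · rintro x' l' e
        obtain ⟨rfl, rfl⟩ := List.cons.inj e
        by_cases hlt : x < y <;> simp [runWeights, hxy, hlt, ih1]

/-! ### Ribbons -/

/-- The number of elements of `S` below `j`. -/
def countBelow (S : Finset ℕ) (j : ℕ) : ℕ := (S.filter (· < j)).card

theorem countBelow_zero (S : Finset ℕ) : countBelow S 0 = 0 := by simp [countBelow]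

theorem countBelow_succ (S : Finset ℕ) (j : ℕ) :
    countBelow S (j + 1) = countBelow S j + if j ∈ S then 1 else 0 := by
  unfold countBelow
  split_ifs with hj
  · have : S.filter (· < j + 1) = insert j (S.filter (· < j)) := by
      ext i
      simp only [mem_filter, mem_insert]
      constructor
      · rintro ⟨h1, h2⟩
        by_cases h3 : i = j
        · exact Or.inl h3
        · exact Or.inr ⟨h1, by omega⟩
      · rintro (rfl | ⟨h1, h2⟩)
        · exact ⟨hj, by omega⟩
        · exact ⟨h1, by omega⟩
    rw [this, card_insert_of_notMem (by simp)]
  · rw [add_zero]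
    congr 1
    ext i
    simp only [mem_filter]
    refine and_congr_right fun hi => ?_
    have : i ≠ j := fun e => hj (e ▸ hi)
    omega

theorem countBelow_mono (S : Finset ℕ) {i j : ℕ} (hij : i ≤ j) :
    countBelow S i ≤ countBelow S j := by
  induction j, hij using Nat.le_induction with
  | base => rfl
  | succ j _ ih =>
    rw [countBelow_succ]
    omega

theorem countBelow_le_add (S : Finset ℕ) {i j : ℕ} (hij : i ≤ j) :
    countBelow S j + i ≤ countBelow S i + j := by
  induction j, hij using Nat.le_induction with
  | base => rfl
  | succ j _ ih =>
    rw [countBelow_succ]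
    split_ifs <;> omega

theorem countBelow_le (S : Finset ℕ) (j : ℕ) : countBelow S j ≤ j := by
  have := countBelow_le_add S (Nat.zero_le j)
  rw [countBelow_zero] at this
  omega

theorem countBelow_eq_card {S : Finset ℕ} {j : ℕ} (hS : S ⊆ range j) :
    countBelow S j = S.card := by
  unfold countBelow
  rw [filter_true_of_mem fun i hi => mem_range.mp (hS hi)]

theorem countBelow_index {n : ℕ} {S : Finset ℕ} (hS : S ⊆ range (n - 1)) {j : ℕ} (hj : j < n) :
    S.card + j + 1 ≤ n + countBelow S j := by
  have := countBelow_le_add S (show j ≤ n - 1 by omega)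
  rw [countBelow_eq_card hS] at this
  omega

/-- The `j`-th cell of the ribbon with vertical steps `S`, starting at the top right end. -/
def ribbonCell (n : ℕ) (S : Finset ℕ) (j : ℕ) : ℕ × ℕ :=
  (countBelow S j, n - 1 - S.card - (j - countBelow S j))

/-- The ribbon of size `n` with vertical steps `S`. -/
def ribbon (n : ℕ) (S : Finset ℕ) : Finset (ℕ × ℕ) := (range n).image (ribbonCell n S)

theorem ribbonCell_eq {n : ℕ} {S : Finset ℕ} (hS : S ⊆ range (n - 1)) {j : ℕ} (hj : j < n) :
    (ribbonCell n S j).1 = countBelow S j ∧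
      (ribbonCell n S j).2 + j + S.card + 1 = n + countBelow S j := by
  have h1 := countBelow_index hS hj
  have h2 := countBelow_le S j
  refine ⟨rfl, ?_⟩
  simp only [ribbonCell]
  omega

/-- Free of truncated subtraction, this shows that the position of a cell along the ribbon is its
row minus its column, up to a constant. -/
theorem mem_ribbon {n : ℕ} {S : Finset ℕ} (hS : S ⊆ range (n - 1)) {x : ℕ × ℕ} :
    x ∈ ribbon n S ↔ ∃ j < n, countBelow S j = x.1 ∧ x.2 + j + S.card + 1 = n + x.1 := by
  simp only [ribbon, mem_image, mem_range]
  refine exists_congr fun j => and_congr_right fun hj => ?_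
  obtain ⟨h1, h2⟩ := ribbonCell_eq hS hj
  constructor
  · rintro rfl
    exact ⟨h1.symm, by omega⟩
  · rintro ⟨h3, h4⟩
    exact Prod.ext (by omega) (by omega)

theorem ribbonCell_injOn {n : ℕ} {S : Finset ℕ} (hS : S ⊆ range (n - 1)) :
    Set.InjOn (ribbonCell n S) (range n) := by
  intro i hi j hj hij
  obtain ⟨h1, h2⟩ := ribbonCell_eq hS (mem_range.mp hi)
  obtain ⟨h3, h4⟩ := ribbonCell_eq hS (mem_range.mp hj)
  rw [hij] at h1 h2
  omega

theorem card_ribbon {n : ℕ} {S : Finset ℕ} (hS : S ⊆ range (n - 1)) : (ribbon n S).card = n := by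
  rw [ribbon, card_image_of_injOn (ribbonCell_injOn hS), card_range]

/-- Skew diagrams are the finite order-convex sets of cells. -/
theorem isSkewDiagram_iff {D : Finset (ℕ × ℕ)} :
    IsSkewDiagram D ↔ ∀ a ∈ D, ∀ c ∈ D, ∀ b, a ≤ b → b ≤ c → b ∈ D := by
  constructor
  · rintro ⟨μ, ν, -, rfl⟩ a ha c hc b hab hbc
    rw [mem_sdiff] at *
    exact ⟨μ.isLowerSet hbc hc.1, fun hb => ha.2 (ν.isLowerSet hab hb)⟩
  · intro hD
    have hfin : {x : ℕ × ℕ | ∃ c ∈ D, x ≤ c}.Finite := by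
      have : {x : ℕ × ℕ | ∃ c ∈ D, x ≤ c} = ⋃ c ∈ D, Set.Iic c := by
        ext x
        simp
      rw [this]
      exact D.finite_toSet.biUnion fun c _ => Set.finite_Iic c
    let μ : YoungDiagram := ⟨hfin.toFinset, by
      intro x y hyx hx
      simp only [Set.Finite.coe_toFinset, Set.mem_ofPred_eq] at hx ⊢
      obtain ⟨c, hc, hxc⟩ := hx
      exact ⟨c, hc, hyx.trans hxc⟩⟩
    have hμ : ∀ x, x ∈ μ.cells ↔ ∃ c ∈ D, x ≤ c := fun x => hfin.mem_toFinset
    let ν : YoungDiagram := ⟨μ.cells \ D, by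
      intro x y hyx hx
      rw [mem_coe, mem_sdiff, hμ] at hx ⊢
      obtain ⟨⟨c, hc, hxc⟩, hx⟩ := hx
      exact ⟨⟨c, hc, hyx.trans hxc⟩, fun hy => hx (hD y hy c hc x hyx hxc)⟩⟩
    refine ⟨μ, ν, ?_, ?_⟩
    · intro x hx
      exact (mem_sdiff.mp hx).1
    · change D = μ.cells \ (μ.cells \ D)
      rw [Finset.sdiff_sdiff_eq_self]
      intro x hx
      exact (hμ x).mpr ⟨x, hx, le_rfl⟩

/-! ### Ribbons are normalized skew hooks. -/

theorem isSkewDiagram_ribbon {n : ℕ} {S : Finset ℕ} (hS : S ⊆ range (n - 1)) :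
    IsSkewDiagram (ribbon n S) := by
  rw [isSkewDiagram_iff]
  intro a ha c hc b hab hbc
  rw [mem_ribbon hS] at *
  obtain ⟨i, hi, h1, h2⟩ := ha
  obtain ⟨j, hj, h3, h4⟩ := hc
  rw [Prod.le_def] at hab hbc
  obtain ⟨h5, h6⟩ := hab
  obtain ⟨h7, h8⟩ := hbc
  have m1 := fun {i j : ℕ} (hij : i ≤ j) => countBelow_mono S hij
  have m2 := fun {i j : ℕ} (hij : i ≤ j) => countBelow_le_add S hij
  -- The only possible position of `b`. Along the ribbon rows weakly increase and columns weakly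
  -- decrease, so comparable cells `a ≤ c` lie in one column (if `i ≤ j`) or in one row (if `j ≤
  -- i`), and `b` lies on the straight segment between them.
  refine ⟨n + b.1 - (b.2 + S.card + 1), ?_⟩
  rcases le_total i j with hij | hij
  · have k1 := m1 hij
    have k2 := m2 hij
    have k3 := m1 (show i ≤ n + b.1 - (b.2 + S.card + 1) by omega)
    have k4 := m1 (show n + b.1 - (b.2 + S.card + 1) ≤ j by omega)
    have k5 := m2 (show i ≤ n + b.1 - (b.2 + S.card + 1) by omega)
    have k6 := m2 (show n + b.1 - (b.2 + S.card + 1) ≤ j by omega)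
    omega
  · have k1 := m1 hij
    have k2 := m2 hij
    have k3 := m1 (show j ≤ n + b.1 - (b.2 + S.card + 1) by omega)
    have k4 := m1 (show n + b.1 - (b.2 + S.card + 1) ≤ i by omega)
    omega

theorem isNormalized_ribbon {n : ℕ} {S : Finset ℕ} (hS : S ⊆ range (n - 1)) :
    IsNormalized (ribbon n S) := by
  rintro ⟨x, hx⟩
  rw [mem_ribbon hS] at hx
  obtain ⟨j, hj, -⟩ := hx
  obtain ⟨h1, h2⟩ := ribbonCell_eq hS (show 0 < n by omega)
  obtain ⟨h3, h4⟩ := ribbonCell_eq hS (show n - 1 < n by omega)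
  rw [countBelow_zero] at h1
  rw [countBelow_eq_card hS] at h3 h4
  exact ⟨⟨_, mem_image_of_mem _ (mem_range.mpr (by omega)), h1⟩,
    ⟨_, mem_image_of_mem _ (mem_range.mpr (show n - 1 < n by omega)), by omega⟩⟩

theorem preconnected_ribbon {n : ℕ} {S : Finset ℕ} (hS : S ⊆ range (n - 1)) :
    ((SimpleGraph.hasse (ℕ × ℕ)).induce (ribbon n S : Set (ℕ × ℕ))).Preconnected := by
  have hmem : ∀ j, j < n → ribbonCell n S j ∈ (ribbon n S : Set (ℕ × ℕ)) :=
    fun j hj => mem_coe.mpr (mem_image_of_mem _ (mem_range.mpr hj))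
  have key : ∀ j (hj : j < n) (h0 : 0 < n),
      ((SimpleGraph.hasse (ℕ × ℕ)).induce (ribbon n S : Set (ℕ × ℕ))).Reachable
        ⟨ribbonCell n S 0, hmem 0 h0⟩ ⟨ribbonCell n S j, hmem j hj⟩ := by
    intro j
    induction j with
    | zero =>
      intro _ _
      exact SimpleGraph.Reachable.refl _
    | succ j ih =>
      intro hj h0
      refine (ih (by omega) h0).trans (SimpleGraph.Adj.reachable ?_)
      rw [SimpleGraph.comap_adj, SimpleGraph.hasse_adj]
      obtain ⟨h1, h2⟩ := ribbonCell_eq hS (show j < n by omega)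
      obtain ⟨h3, h4⟩ := ribbonCell_eq hS hj
      rw [countBelow_succ] at h3 h4
      simp only [Function.Embedding.subtype_apply, Prod.covBy_iff, Nat.covBy_iff_add_one_eq]
      split_ifs at h3 h4 <;> omega
  rintro ⟨x, hx⟩ ⟨y, hy⟩
  obtain ⟨i, hi, rfl⟩ := mem_image.mp (mem_coe.mp hx)
  obtain ⟨j, hj, rfl⟩ := mem_image.mp (mem_coe.mp hy)
  have hi := mem_range.mp hi
  have hj := mem_range.mp hj
  exact (key i hi (by omega)).symm.trans (key j hj (by omega))

theorem isSkewHook_ribbon {n : ℕ} {S : Finset ℕ} (hS : S ⊆ range (n - 1)) :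
    IsSkewHook (ribbon n S) := by
  refine ⟨isSkewDiagram_ribbon hS, preconnected_ribbon hS, ?_⟩
  rintro ⟨i, j, h1, -, -, h2⟩
  rw [mem_ribbon hS] at h1 h2
  obtain ⟨a, ha, h3, h4⟩ := h1
  obtain ⟨b, hb, h5, h6⟩ := h2
  simp only at h3 h4 h5 h6
  -- Opposite corners of a square have the same row minus column, hence the same position on the
  -- ribbon.
  obtain rfl : a = b := by omega
  omega

/-- A discrete intermediate value argument: the number `j - countBelow S j` of horizontal steps
starts at 0 and grows by at most one. It shows that a ribbon skips no column. -/
theorem exists_horizontal (S : Finset ℕ) {v J : ℕ} (hv : v + countBelow S J ≤ J) :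
    ∃ j ≤ J, v + countBelow S j = j := by
  induction J with
  | zero => exact ⟨0, le_rfl, by rw [countBelow_zero] at *; omega⟩
  | succ J ih =>
    by_cases hh : v + countBelow S J ≤ J
    · obtain ⟨j, hj, e⟩ := ih hh
      exact ⟨j, by omega, e⟩
    · refine ⟨J + 1, le_rfl, ?_⟩
      rw [countBelow_succ] at *
      omega

theorem card_columns_ribbon {n : ℕ} {S : Finset ℕ} (hS : S ⊆ range (n - 1)) :
    (columns (ribbon n S)).card = n - S.card := by
  have hle := card_le_card hS
  rw [card_range] at hle
  have : columns (ribbon n S) = range (n - S.card) := by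
    ext c
    simp only [columns, mem_image, mem_range, mem_ribbon hS]
    constructor
    · rintro ⟨x, ⟨j, hj, h1, h2⟩, rfl⟩
      have := countBelow_le S j
      omega
    · intro hc
      obtain ⟨j, hj, e⟩ := exists_horizontal S (v := n - 1 - S.card - c) (J := n - 1)
        (by rw [countBelow_eq_card hS]; omega)
      exact ⟨(countBelow S j, c), ⟨j, by omega, rfl, by simp only; omega⟩, rfl⟩
  rw [this, card_range]

theorem columnSize_pos {D : Finset (ℕ × ℕ)} {c : ℕ} (hc : c ∈ columns D) : 0 < columnSize D c := by
  obtain ⟨x, hx, rfl⟩ := mem_image.mp hc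
  exact card_pos.mpr ⟨x, mem_filter.mpr ⟨hx, rfl⟩⟩

theorem columnSize_ribbon_le_two {n : ℕ} {S : Finset ℕ} (hS : S ⊆ range (n - 1)) :
    (∀ c ∈ columns (ribbon n S), columnSize (ribbon n S) c = 1 ∨ columnSize (ribbon n S) c = 2) ↔
      NoConsec S := by
  constructor
  · intro hh i hi hi'
    have hi2 := mem_range.mp (hS hi')
    obtain ⟨a1, a2⟩ := ribbonCell_eq hS (show i < n by omega)
    obtain ⟨b1, b2⟩ := ribbonCell_eq hS (show i + 1 < n by omega)
    obtain ⟨c1, c2⟩ := ribbonCell_eq hS (show i + 2 < n by omega)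
    rw [countBelow_succ, if_pos hi'] at c1 c2
    rw [countBelow_succ, if_pos hi] at b1 b2 c1 c2
    -- Two consecutive vertical steps put three cells into one column.
    have hsub : ({ribbonCell n S i, ribbonCell n S (i + 1), ribbonCell n S (i + 2)} :
        Finset (ℕ × ℕ)) ⊆ (ribbon n S).filter fun x => x.2 = (ribbonCell n S i).2 := by
      intro x hx
      simp only [mem_insert, mem_singleton] at hx
      rw [mem_filter]
      rcases hx with rfl | rfl | rfl
      · exact ⟨mem_image_of_mem _ (mem_range.mpr (by omega)), rfl⟩
      · exact ⟨mem_image_of_mem _ (mem_range.mpr (by omega)), by omega⟩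
      · exact ⟨mem_image_of_mem _ (mem_range.mpr (by omega)), by omega⟩
    have hcard := card_le_card hsub
    rw [card_eq_three.mpr ⟨_, _, _, ?_, ?_, ?_, rfl⟩] at hcard
    · have := hh _ (mem_image_of_mem _ (mem_image_of_mem _ (mem_range.mpr (show i < n by omega))))
      rw [columnSize] at this
      omega
    · intro e
      rw [e] at a1
      omega
    · intro e
      rw [e] at a1
      omega
    · intro e
      rw [e] at b1
      omega
  · intro hc c hcol
    have h1 := columnSize_pos hcol
    suffices columnSize (ribbon n S) c ≤ 2 by omega
    by_contra! hlt
    obtain ⟨x, hx, y, hy, z, hz, hxy, hxz, hyz⟩ := two_lt_card.mp hlt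
    -- Among two successive steps one is horizontal, so cells of one column are at most one position
    -- apart; three distinct positions cannot satisfy this.
    have gap : ∀ i j, i + 2 ≤ j → countBelow S j + i + 1 ≤ countBelow S i + j := by
      intro i j hij
      have k1 := countBelow_le_add S hij
      have k2 : countBelow S (i + 2) = _ := countBelow_succ S (i + 1)
      have k3 := countBelow_succ S i
      have k4 := hc i
      split_ifs at k2 k3 <;> first | omega | exact absurd ‹i + 1 ∈ S› (k4 ‹_›)
    simp only [mem_filter, mem_ribbon hS] at hx hy hz
    obtain ⟨⟨i, hi, a1, a2⟩, a3⟩ := hx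
    obtain ⟨⟨j, hj, b1, b2⟩, b3⟩ := hy
    obtain ⟨⟨k, hk, c1, c2⟩, c3⟩ := hz
    have e1 : i ≠ j := fun e => hxy (Prod.ext (by rw [← a1, ← b1, e]) (by omega))
    have e2 : i ≠ k := fun e => hxz (Prod.ext (by rw [← a1, ← c1, e]) (by omega))
    have e3 : j ≠ k := fun e => hyz (Prod.ext (by rw [← b1, ← c1, e]) (by omega))
    have g1 := gap i j
    have g2 := gap j i
    have g3 := gap i k
    have g4 := gap k i
    have g5 := gap j k
    have g6 := gap k j
    omega

theorem card_columns_of_columnSize {D : Finset (ℕ × ℕ)}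
    (hD : ∀ c ∈ columns D, columnSize D c = 1 ∨ columnSize D c = 2) :
    ((columns D).filter fun c => columnSize D c = 1).card +
      ((columns D).filter fun c => columnSize D c = 2).card = (columns D).card ∧
    ((columns D).filter fun c => columnSize D c = 1).card +
      2 * ((columns D).filter fun c => columnSize D c = 2).card = D.card := by
  have e : (columns D).filter (fun c => columnSize D c = 2) =
      (columns D).filter fun c => ¬ columnSize D c = 1 := by
    refine filter_congr fun c hc => ?_
    have := hD c hc
    omega
  refine ⟨by rw [e, card_filter_add_card_filter_not], ?_⟩
  have h1 : D.card = ∑ c ∈ columns D, columnSize D c :=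
    card_eq_sum_card_fiberwise fun x hx => mem_image_of_mem _ hx
  rw [h1, ← sum_filter_add_sum_filter_not _ fun c => columnSize D c = 1, ← e]
  rw [sum_congr rfl fun c hc => (mem_filter.mp hc).2, sum_congr rfl fun c hc => (mem_filter.mp hc).2]
  simp [mul_comm]

/-- With `u` columns of size 1 and `v` of size 2, `u + v = n - S.card` and `u + 2 * v = n`, so `v =
S.card`. -/
theorem ribbon_mem_skewHooks {n k : ℕ} {S : Finset ℕ} (hS : S ⊆ range (n - 1)) :
    ribbon n S ∈ skewHooks n k ↔ NoConsec S ∧ S.card = k := by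
  have h1 := card_columns_ribbon hS
  have h2 := card_ribbon hS
  have h3 := card_le_card hS
  rw [card_range] at h3
  constructor
  · rintro ⟨-, -, -, h4, h5, -⟩
    have h6 := card_columns_of_columnSize h4
    exact ⟨(columnSize_ribbon_le_two hS).mp h4, by omega⟩
  · rintro ⟨hc, rfl⟩
    have h4 := (columnSize_ribbon_le_two hS).mpr hc
    have h6 := card_columns_of_columnSize h4
    exact ⟨isSkewHook_ribbon hS, isNormalized_ribbon hS, h2, h4, by omega, by omega⟩

/-! ### Every skew hook is a ribbon -/

/-- Of two distinct cells with equal row minus column, one is strictly above and to the left of the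
other; order-convexity would then produce a `2 × 2` square. -/
theorem eq_of_antidiagonalIndex_eq {D : Finset (ℕ × ℕ)} (hD : IsSkewHook D) {C : ℕ}
    (hC : ∀ x ∈ D, x.2 ≤ C) {x y : ℕ × ℕ} (hx : x ∈ D) (hy : y ∈ D)
    (hxy : x.1 + (C - x.2) = y.1 + (C - y.2)) : x = y := by
  wlog hle : x.1 ≤ y.1 generalizing x y
  · exact (this hy hx hxy.symm (by omega)).symm
  have h1 := hC x hx
  have h2 := hC y hy
  obtain ⟨hskew, -, hsq⟩ := hD
  rw [isSkewDiagram_iff] at hskew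
  rcases hle.eq_or_lt with e | hlt
  · exact Prod.ext e (by omega)
  · refine absurd ⟨x.1, x.2, hx, ?_, ?_, ?_⟩ hsq <;>
    · refine hskew x hx y hy _ (Prod.le_def.mpr ?_) (Prod.le_def.mpr ?_) <;> constructor <;> simp only <;>
      omega

theorem exists_adj_of_walk {V : Type*} {G : SimpleGraph V} (f : V → ℕ)
    (hf : ∀ a b, G.Adj a b → f b ≤ f a + 1) {u w : V} (p : G.Walk u w) {v : ℕ}
    (hu : f u ≤ v) (hw : v < f w) : ∃ a b, G.Adj a b ∧ f a = v ∧ f b = v + 1 := by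
  obtain ⟨d, -, h1, h2⟩ := p.exists_boundary_dart {a | f a ≤ v} hu (by simpa using hw)
  have := hf _ _ d.adj
  simp only [Set.mem_ofPred_eq] at h1 h2
  exact ⟨d.fst, d.snd, d.adj, by omega, by omega⟩

/-- Row minus column, shifted to `f`, is injective on `D`. By connectedness its values form an
interval, and successive cells differ by a step down or left. The downward steps form `S`, and
normalization fixes the position. -/
theorem exists_eq_ribbon {D : Finset (ℕ × ℕ)} (hD : IsSkewHook D) (hnorm : IsNormalized D) :
    ∃ S ⊆ range (D.card - 1), D = ribbon D.card S := by
  rcases D.eq_empty_or_nonempty with rfl | hne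
  · exact ⟨∅, by simp, by simp [ribbon]⟩
  obtain ⟨⟨r, hrD, hr⟩, ⟨s, hsD, hs⟩⟩ := hnorm hne
  obtain ⟨e, heD, he⟩ := D.exists_max_image Prod.snd hne
  set C := e.2 with hCdef
  set f : ℕ × ℕ → ℕ := fun x => x.1 + (C - x.2) with hf
  have hinj : ∀ x ∈ D, ∀ y ∈ D, f x = f y → x = y := fun x hx y hy hxy =>
    eq_of_antidiagonalIndex_eq hD he hx hy hxy
  -- The only way to go from one antidiagonal to the next is one step left or down.
  have hstep : ∀ u ∈ D, ∀ w ∈ D, ∀ v, f u ≤ v → v < f w → ∃ a ∈ D, ∃ b ∈ D, f a = v ∧ f b = v + 1 ∧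
      (b.1 = a.1 + 1 ∧ b.2 = a.2 ∨ b.1 = a.1 ∧ b.2 + 1 = a.2) := by
    intro u hu w hw v h1 h2
    obtain ⟨p⟩ := hD.2.1 ⟨u, hu⟩ ⟨w, hw⟩
    have hadj : ∀ a b : (D : Set (ℕ × ℕ)),
        ((SimpleGraph.hasse (ℕ × ℕ)).induce (D : Set (ℕ × ℕ))).Adj a b →
        (a.1.1 + 1 = b.1.1 ∧ a.1.2 = b.1.2 ∨ a.1.2 + 1 = b.1.2 ∧ a.1.1 = b.1.1) ∨
        (b.1.1 + 1 = a.1.1 ∧ b.1.2 = a.1.2 ∨ b.1.2 + 1 = a.1.2 ∧ b.1.1 = a.1.1) := by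
      intro a b hab
      rw [SimpleGraph.comap_adj, SimpleGraph.hasse_adj] at hab
      simpa only [Function.Embedding.subtype_apply, Prod.covBy_iff, Nat.covBy_iff_add_one_eq]
        using hab
    obtain ⟨a, b, hab, ha, hb⟩ := exists_adj_of_walk (fun x : (D : Set (ℕ × ℕ)) => f x.1)
      (by
        intro a b hab
        have := hadj a b hab
        simp only [hf]
        omega) p h1 h2
    have h3 := hadj a b hab
    have h4 := he a.1 a.2
    have h5 := he b.1 b.2
    refine ⟨a.1, a.2, b.1, b.2, ha, hb, ?_⟩
    simp only [hf] at ha hb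
    omega
  obtain ⟨p, hpD, hp⟩ := D.exists_min_image f hne
  have hcorner : ∀ v, ∀ x ∈ D, f x = v → p.1 ≤ x.1 ∧ x.2 ≤ p.2 := by
    intro v
    induction v with
    | zero =>
      intro x hx hxv
      rw [hinj x hx p hpD (by have := hp x hx; omega)]
      exact ⟨le_rfl, le_rfl⟩
    | succ v ih =>
      intro x hx hxv
      by_cases hpv : f p ≤ v
      · obtain ⟨a, ha, b, hb, h1, h2, h3⟩ := hstep p hpD x hx v hpv (by omega)
        obtain rfl := hinj b hb x hx (by omega)
        have := ih a ha h1
        omega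
      · rw [hinj x hx p hpD (by have := hp x hx; omega)]
        exact ⟨le_rfl, le_rfl⟩
  -- Every cell is reached from `p` by steps down and left, so `p` lies in the top row, which is row
  -- 0 by normalization, and in the rightmost column `C`.
  have hp0 : f p = 0 := by
    have h1 := hcorner _ r hrD rfl
    have h2 := hcorner _ e heD rfl
    simp only [hf]
    omega
  have himg : D.image f = range D.card := by
    refine eq_of_subset_of_card_le ?_ ?_
    · intro v hv
      obtain ⟨x, hx, hxv⟩ := mem_image.mp hv
      have : range (v + 1) ⊆ D.image f := by
        intro w hw
        rcases (Nat.lt_succ_iff.mp (mem_range.mp hw)).eq_or_lt with rfl | hlt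
        · exact hv
        · obtain ⟨a, ha, -, -, h1, -⟩ := hstep p hpD x hx w (by omega) (by omega)
          exact mem_image.mpr ⟨a, ha, h1⟩
      have := card_le_card this
      rw [card_image_of_injOn (fun x hx y hy => hinj x hx y hy), card_range] at this
      exact mem_range.mpr this
    · rw [card_range, card_image_of_injOn (fun x hx y hy => hinj x hx y hy)]
  have hex : ∀ v, ∃ x, v < D.card → x ∈ D ∧ f x = v := by
    intro v
    by_cases hv : v < D.card
    · rw [← mem_range, ← himg] at hv
      obtain ⟨x, hx, hxv⟩ := mem_image.mp hv
      exact ⟨x, fun _ => ⟨hx, hxv⟩⟩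
    · exact ⟨p, fun h => absurd h hv⟩
  choose P hP using hex
  have hcons : ∀ v, v + 1 < D.card →
      ((P (v + 1)).1 = (P v).1 + 1 ∧ (P (v + 1)).2 = (P v).2 ∨
        (P (v + 1)).1 = (P v).1 ∧ (P (v + 1)).2 + 1 = (P v).2) := by
    intro v hv
    obtain ⟨h1, h2⟩ := hP v (by omega)
    obtain ⟨h3, h4⟩ := hP (v + 1) hv
    obtain ⟨a, ha, b, hb, h5, h6, h7⟩ := hstep _ h1 _ h3 v (by omega) (by omega)
    rwa [hinj a ha _ h1 (by omega), hinj b hb _ h3 (by omega)] at h7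
  have hcard := card_pos.mpr hne
  set S := (range (D.card - 1)).filter fun v => (P (v + 1)).1 = (P v).1 + 1 with hS
  have hSsub : S ⊆ range (D.card - 1) := filter_subset _ _
  have hrow : ∀ v, v < D.card → (P v).1 = countBelow S v := by
    intro v
    induction v with
    | zero =>
      intro h0
      obtain ⟨h1, h2⟩ := hP 0 h0
      rw [countBelow_zero]
      simp only [hf] at h2
      omega
    | succ v ih =>
      intro hv
      have h1 := hcons v hv
      have h2 := ih (by omega)
      have h3 : v ∈ S ↔ (P (v + 1)).1 = (P v).1 + 1 := by
        simp only [hS, mem_filter, mem_range]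
        exact and_iff_right (by omega)
      rw [countBelow_succ]
      split_ifs with hvS
      · rw [h3.mp hvS, h2]
      · rw [h3] at hvS
        omega
  have hlast : (P (D.card - 1)).2 = 0 := by
    have hle : ∀ w, ∀ v, v + w < D.card → (P (v + w)).2 ≤ (P v).2 := by
      intro w
      induction w with
      | zero => simp
      | succ w ih =>
        intro v hv
        have h1 := hcons (v + w) hv
        have h2 := ih v (by omega)
        rw [add_assoc] at h1
        omega
    have hsv : f s < D.card := by
      rw [← mem_range, ← himg]
      exact mem_image_of_mem _ hsD
    have h1 := hle (D.card - 1 - f s) (f s) (by omega)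
    obtain ⟨h2, h3⟩ := hP _ hsv
    rw [hinj _ h2 s hsD h3, hs, show f s + (D.card - 1 - f s) = D.card - 1 by omega] at h1
    omega
  -- The last cell has column 0 and row `S.card`, while its index is `D.card - 1`.
  have hC : C + S.card + 1 = D.card := by
    obtain ⟨h1, h2⟩ := hP (D.card - 1) (by omega)
    have h3 := hrow (D.card - 1) (by omega)
    rw [countBelow_eq_card hSsub] at h3
    simp only [hf] at h2
    omega
  refine ⟨S, hSsub, ?_⟩
  refine eq_of_subset_of_card_le ?_ (card_ribbon hSsub).le
  intro x hx
  have hxv : f x < D.card := by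
    rw [← mem_range, ← himg]
    exact mem_image_of_mem _ hx
  obtain ⟨h2, h3⟩ := hP _ hxv
  have h4 := hrow _ hxv
  rw [hinj _ h2 x hx h3] at h4
  rw [mem_ribbon hSsub]
  refine ⟨f x, hxv, h4.symm, ?_⟩
  have := he x hx
  simp only [hf]
  omega

/-- The number of columns determines the cardinality, hence the position of each cell; the rows then
give `countBelow`, whose increments recover the set. -/
theorem ribbon_injective {n : ℕ} {S S' : Finset ℕ} (hS : S ⊆ range (n - 1))
    (hS' : S' ⊆ range (n - 1)) (hr : ribbon n S = ribbon n S') : S = S' := by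
  have hcard : S.card = S'.card := by
    have := card_columns_ribbon hS
    rw [hr, card_columns_ribbon hS'] at this
    have h1 := card_le_card hS
    have h2 := card_le_card hS'
    rw [card_range] at h1 h2
    omega
  have hcount : ∀ j < n, countBelow S j = countBelow S' j := by
    intro j hj
    have hmem : ribbonCell n S j ∈ ribbon n S' := by
      rw [← hr]
      exact mem_image_of_mem _ (mem_range.mpr hj)
    obtain ⟨h1, h2⟩ := ribbonCell_eq hS hj
    obtain ⟨i, hi, h3, h4⟩ := (mem_ribbon hS').mp hmem
    obtain rfl : i = j := by omega
    omega
  ext i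
  by_cases hi : i < n - 1
  · have h1 := hcount i (by omega)
    have h2 := hcount (i + 1) (by omega)
    rw [countBelow_succ, countBelow_succ, h1] at h2
    by_cases a : i ∈ S <;> by_cases b : i ∈ S' <;> simp_all
  · exact ⟨fun h => absurd (mem_range.mp (hS h)) hi, fun h => absurd (mem_range.mp (hS' h)) hi⟩

/-- The possible sets of strict ascents of the words of length `n` with `k` strict ascents, no two
of them consecutive. -/
noncomputable def ascSets (n k : ℕ) : Finset (Finset ℕ) :=
  open Classical in (range (n - 1)).powerset.filter fun S => NoConsec S ∧ S.card = k

theorem mem_ascSets {n k : ℕ} {S : Finset ℕ} :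
    S ∈ ascSets n k ↔ S ⊆ range (n - 1) ∧ NoConsec S ∧ S.card = k := by
  simp [ascSets]

theorem skewHooks_eq_image (n k : ℕ) :
    (finite_skewHooks n k).toFinset = (ascSets n k).image (ribbon n) := by
  ext D
  rw [Set.Finite.mem_toFinset, mem_image]
  constructor
  · intro hD
    obtain ⟨S, hS, e⟩ := exists_eq_ribbon hD.1 hD.2.1
    rw [hD.2.2.1] at hS e
    rw [e, ribbon_mem_skewHooks hS] at hD
    exact ⟨S, mem_ascSets.mpr ⟨hS, hD⟩, e.symm⟩
  · rintro ⟨S, hS, rfl⟩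
    rw [mem_ascSets] at hS
    exact (ribbon_mem_skewHooks hS.1).mpr hS.2

/-! ### Tableaux of ribbon shape are words with a given set of strict ascents -/

/-- The hypothesis `hc` says that no step between `i` and `j` is an ascent: the two positions lie in
one row of the ribbon. -/
theorem getD_le_of_countBelow_eq {l : List ℕ} {i j : ℕ} (hij : i ≤ j) (hj : j < l.length)
    (hc : countBelow (ascSet l) i = countBelow (ascSet l) j) : l.getD j 0 ≤ l.getD i 0 := by
  induction j, hij using Nat.le_induction with
  | base => rfl
  | succ j hij ih =>
    have h1 := countBelow_mono (ascSet l) hij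
    rw [countBelow_succ] at hc
    have h2 := ih (by omega) (by omega)
    by_cases hm : j ∈ ascSet l
    · rw [if_pos hm] at hc
      omega
    · rw [mem_ascSet] at hm
      push Not at hm
      exact (hm hj).trans h2

/-- Here `hc` says that every step between `i` and `j` is an ascent: the two positions lie in one
column. -/
theorem getD_lt_of_countBelow {l : List ℕ} {i j : ℕ} (hij : i < j) (hj : j < l.length)
    (hc : countBelow (ascSet l) i + j = countBelow (ascSet l) j + i) :
    l.getD i 0 < l.getD j 0 := by
  -- Letters grow by at least one per step; in this form the induction can start at `j = i`.
  suffices l.getD i 0 + j ≤ l.getD j 0 + i by omega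
  have hle : i ≤ j := hij.le
  clear hij
  induction j, hle using Nat.le_induction with
  | base => rfl
  | succ j hij ih =>
    have h1 := countBelow_le_add (ascSet l) hij
    rw [countBelow_succ] at hc
    by_cases hm : j ∈ ascSet l
    · rw [if_pos hm] at hc
      have h2 := ih (by omega) (by omega)
      have h3 := (mem_ascSet.mp hm).2
      omega
    · rw [if_neg hm] at hc
      omega

theorem SkewTableau.ext' {D : Finset (ℕ × ℕ)} {T T' : SkewTableau D}
    (hT : ∀ c, T.entry c = T'.entry c) : T = T' := by
  obtain ⟨e, _, _⟩ := T
  obtain ⟨e', _, _⟩ := T'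
  obtain rfl : e = e' := funext hT
  rfl

theorem wordContent_eq_sum (l : List ℕ) :
    wordContent l = ∑ j ∈ range l.length, Finsupp.single (l.getD j 0) 1 := by
  induction l with
  | nil => simp [wordContent]
  | cons x l ih =>
    rw [List.length_cons, sum_range_succ']
    simp only [List.getD_cons_succ, List.getD_cons_zero]
    rw [← ih, wordContent, wordContent, ← Multiset.cons_coe, ← Multiset.singleton_add, map_add,
      Multiset.toFinsupp_singleton, add_comm]

theorem ribbonCell_mem {n j : ℕ} (S : Finset ℕ) (hj : j < n) : ribbonCell n S j ∈ ribbon n S :=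
  mem_image_of_mem _ (mem_range.mpr hj)

/-- The reading word of a tableau of ribbon shape, from the top right to the bottom left. -/
def SkewTableau.word {n : ℕ} {S : Finset ℕ} (T : SkewTableau (ribbon n S)) : List ℕ :=
  List.ofFn fun j : Fin n => T.entry ⟨ribbonCell n S j, ribbonCell_mem S j.2⟩

theorem SkewTableau.getD_word {n : ℕ} {S : Finset ℕ} (T : SkewTableau (ribbon n S)) {j : ℕ}
    (hj : j < n) : T.word.getD j 0 = T.entry ⟨ribbonCell n S j, ribbonCell_mem S hj⟩ := by
  simp [SkewTableau.word, List.getD_eq_getElem?_getD, hj]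

theorem SkewTableau.length_word {n : ℕ} {S : Finset ℕ} (T : SkewTableau (ribbon n S)) :
    T.word.length = n := by
  simp [SkewTableau.word]

theorem SkewTableau.ascSet_word {n : ℕ} {S : Finset ℕ} (hS : S ⊆ range (n - 1))
    (T : SkewTableau (ribbon n S)) : ascSet T.word = S := by
  ext i
  rw [mem_ascSet, T.length_word]
  by_cases hi : i + 1 < n
  · rw [T.getD_word hi, T.getD_word (by omega)]
    obtain ⟨h1, h2⟩ := ribbonCell_eq hS (show i < n by omega)
    obtain ⟨h3, h4⟩ := ribbonCell_eq hS hi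
    rw [countBelow_succ] at h3 h4
    by_cases hm : i ∈ S
    · rw [if_pos hm] at h3 h4
      simp only [hm, hi, true_and, iff_true]
      exact T.col_strict _ _ (by simp only; omega) (by simp only; omega)
    · rw [if_neg hm] at h3 h4
      simp only [hm, hi, true_and, iff_false, not_lt]
      exact T.row_weak _ _ (by simp only; omega) (by simp only; omega)
  · refine ⟨fun hh => absurd hh.1 hi, fun hh => ?_⟩
    have := mem_range.mp (hS hh)
    omega

theorem SkewTableau.wordContent_word {n : ℕ} {S : Finset ℕ} (hS : S ⊆ range (n - 1))
    (T : SkewTableau (ribbon n S)) : wordContent T.word = T.content := by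
  rw [wordContent_eq_sum, T.length_word, SkewTableau.content]
  refine sum_bij (fun j hj => ⟨ribbonCell n S j, ribbonCell_mem S (mem_range.mp hj)⟩)
    (fun _ _ => mem_univ _) ?_ ?_ ?_
  · intro i hi j hj hij
    exact ribbonCell_injOn hS hi hj (congrArg Subtype.val hij)
  · rintro ⟨x, hx⟩ -
    obtain ⟨j, hj, rfl⟩ := mem_image.mp hx
    exact ⟨j, hj, rfl⟩
  · intro j hj
    rw [T.getD_word (mem_range.mp hj)]

theorem SkewTableau.word_injective {n : ℕ} {S : Finset ℕ} :
    Function.Injective (SkewTableau.word : SkewTableau (ribbon n S) → List ℕ) := by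
  intro T T' hT
  refine SkewTableau.ext' ?_
  rintro ⟨x, hx⟩
  obtain ⟨j, hj, rfl⟩ := mem_image.mp hx
  have hj := mem_range.mp hj
  have := congrArg (fun l => l.getD j 0) hT
  simpa only [SkewTableau.getD_word _ hj] using this

theorem SkewTableau.exists_word_eq {l : List ℕ} :
    ∃ T : SkewTableau (ribbon l.length (ascSet l)), T.word = l := by
  have hS := ascSet_subset l
  set n := l.length with hn
  refine ⟨⟨fun x => l.getD (n + x.1.1 - (x.1.2 + (ascSet l).card + 1)) 0, ?_, ?_⟩, ?_⟩
  · rintro ⟨x, hx⟩ ⟨y, hy⟩ h1 h2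
    obtain ⟨i, hi, h3, h4⟩ := (mem_ribbon hS).mp hx
    obtain ⟨j, hj, h5, h6⟩ := (mem_ribbon hS).mp hy
    simp only at h1 h2 ⊢
    rw [show n + x.1 - (x.2 + (ascSet l).card + 1) = i by omega,
      show n + y.1 - (y.2 + (ascSet l).card + 1) = j by omega]
    exact getD_le_of_countBelow_eq (by omega) (by omega) (by omega)
  · rintro ⟨x, hx⟩ ⟨y, hy⟩ h1 h2
    obtain ⟨i, hi, h3, h4⟩ := (mem_ribbon hS).mp hx
    obtain ⟨j, hj, h5, h6⟩ := (mem_ribbon hS).mp hy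
    simp only at h1 h2 ⊢
    rw [show n + x.1 - (x.2 + (ascSet l).card + 1) = i by omega,
      show n + y.1 - (y.2 + (ascSet l).card + 1) = j by omega]
    exact getD_lt_of_countBelow (by omega) (by omega) (by omega)
  · refine List.ext_getElem (by simp [SkewTableau.word, hn]) fun j h1 h2 => ?_
    obtain ⟨h3, h4⟩ := ribbonCell_eq hS h2
    simp only [SkewTableau.word, List.getElem_ofFn]
    rw [show n + (ribbonCell n (ascSet l) j).1 -
      ((ribbonCell n (ascSet l) j).2 + (ascSet l).card + 1) = j by omega]
    simp [List.getD_eq_getElem?_getD, h2]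

/-- The reading word is a content-preserving bijection: vertical steps impose strict ascents,
horizontal steps weak descents. -/
theorem skewSchur_ribbon {n : ℕ} {S : Finset ℕ} (hS : S ⊆ range (n - 1)) :
    skewSchur (ribbon n S) = wordSum n fun l => if ascSet l = S then 1 else 0 := by
  ext m
  rw [coeff_wordSum, ← sum_filter, sum_const, nsmul_eq_mul, mul_one]
  change (Nat.card _ : ℝ) = _
  congr 1
  rw [← Nat.card_eq_finsetCard]
  refine Nat.card_congr (Equiv.ofBijective (fun T => ⟨T.1.word, ?_⟩) ⟨?_, ?_⟩)
  · simp only [mem_filter, mem_words]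
    exact ⟨⟨(T.1.wordContent_word hS).trans T.2, T.1.length_word⟩, T.1.ascSet_word hS⟩
  · intro T T' hT
    exact Subtype.ext (SkewTableau.word_injective (congrArg Subtype.val hT))
  · rintro ⟨l, hl⟩
    simp only [mem_filter, mem_words] at hl
    obtain ⟨⟨rfl, rfl⟩, rfl⟩ := hl
    obtain ⟨T, hT⟩ := SkewTableau.exists_word_eq (l := l)
    exact ⟨⟨T, by rw [← T.wordContent_word hS, hT]⟩, Subtype.ext hT⟩

theorem gammaTilde_eq_wordSum (n k : ℕ) :
    gammaTilde n k = wordSum n fun l => if ascSet l ∈ ascSets n k then 1 else 0 := by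
  rw [gammaTilde, skewHooks_eq_image, sum_image]
  · rw [sum_congr rfl fun S hS => skewSchur_ribbon (mem_ascSets.mp hS).1, ← wordSum_sum]
    refine wordSum_congr fun l _ => ?_
    rw [sum_ite_eq]
  · intro S hS S' hS' e
    exact ribbon_injective (mem_ascSets.mp hS).1 (mem_ascSets.mp hS').1 e

theorem evalAt_sum_gammaTilde (t : ℝ) (n : ℕ) :
    evalAt t (∑ k ∈ range (n / 2 + 1), Polynomial.C (gammaTilde n k) * Polynomial.X ^ k *
        (1 + Polynomial.X) ^ (n - 2 * k)) =
      wordSum n fun l => (runWeights (1 + t) t l).1 := by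
  classical
  have hX : evalAt t Polynomial.X = MvPowerSeries.C t := by simp [evalAt]
  have hC : ∀ f, evalAt t (Polynomial.C f) = f := fun f => by simp [evalAt]
  simp only [map_sum, map_mul, map_pow, map_add, map_one, hX, hC]
  have : ∀ k ∈ range (n / 2 + 1), gammaTilde n k * MvPowerSeries.C t ^ k *
      (1 + MvPowerSeries.C t) ^ (n - 2 * k) = wordSum n fun l => (t ^ k * (1 + t) ^ (n - 2 * k)) *
        if ascSet l ∈ ascSets n k then 1 else 0 := by
    intro k _
    rw [wordSum_smul, smul_eq_C_mul, gammaTilde_eq_wordSum]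
    simp only [map_mul, map_pow, map_add, map_one]
    ring
  rw [sum_congr rfl this, ← wordSum_sum]
  refine wordSum_congr fun l hl => ?_
  rw [(runWeights_eq _ _ l).1, ascWeight]
  subst hl
  have hS := ascSet_subset l
  simp only [mem_ascSets, hS, true_and]
  split_ifs with hc
  · have := two_mul_card_le hS hc
    simp only [hc, true_and, mul_ite, mul_one, mul_zero]
    rw [sum_ite_eq, if_pos (mem_range.mpr (by omega))]
  · simp [hc]

theorem QTilde_eq_sum (n : ℕ) :
    QTilde n = ∑ k ∈ range (n / 2 + 1), Polynomial.C (gammaTilde n k) * Polynomial.X ^ k *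
        (1 + Polynomial.X) ^ (n - 2 * k) :=
  eq_of_evalAt fun t ht => (evalAt_QTilde ht n).trans (evalAt_sum_gammaTilde t n).symm

/-! ### Gelfand–Tsetlin patterns and row insertion

A semistandard tableau of straight shape is encoded by the numbers `a r i` of its entries less than
`i` in row `r`. -/

/-- The encodings of semistandard tableaux (without condition on the shape). -/
structure IsPattern (a : ℕ → ℕ → ℕ) : Prop where
  zero : ∀ r, a r 0 = 0
  le_succ : ∀ r i, a r i ≤ a r (i + 1)
  interlace : ∀ r i, a (r + 1) (i + 1) ≤ a r i

theorem IsPattern.mono {a : ℕ → ℕ → ℕ} (ha : IsPattern a) (r : ℕ) : Monotone (a r) :=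
  monotone_nat_of_le_succ (ha.le_succ r)

theorem IsPattern.succ_row_le {a : ℕ → ℕ → ℕ} (ha : IsPattern a) (r i : ℕ) : a (r + 1) i ≤ a r i :=
  (ha.le_succ _ _).trans (ha.interlace r i)

theorem IsPattern.antitone {a : ℕ → ℕ → ℕ} (ha : IsPattern a) (i : ℕ) :
    Antitone fun r => a r i :=
  antitone_nat_of_succ_le fun r => ha.succ_row_le r i

/-- The bumping path of the insertion of the letter `x`: the tableau formed by the letters less than
`i` gets a new cell in row `r` if the value at `i` is `r + 1`, and no new cell if it is `0`. -/
def bumpPath (a : ℕ → ℕ → ℕ) (x : ℕ) : ℕ → ℕ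
  | 0 => 0
  | i + 1 => if i = x then 1 else if bumpPath a x i = 0 then 0 else
      bumpPath a x i + if a (bumpPath a x i - 1) i < a (bumpPath a x i - 1) (i + 1) then 1 else 0

/-- Row insertion of the letter `x`. -/
def rowInsert (a : ℕ → ℕ → ℕ) (x : ℕ) (r i : ℕ) : ℕ :=
  a r i + if bumpPath a x i = r + 1 then 1 else 0

section

variable {a : ℕ → ℕ → ℕ} {x : ℕ}

theorem bumpPath_of_le {i : ℕ} (hi : i ≤ x) : bumpPath a x i = 0 := by
  induction i with
  | zero => rfl
  | succ i ih => rw [bumpPath, if_neg (by omega), if_pos (ih (by omega))]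

theorem bumpPath_self : bumpPath a x (x + 1) = 1 := by rw [bumpPath, if_pos rfl]

theorem bumpPath_pos {i : ℕ} (hi : x < i) : 0 < bumpPath a x i := by
  induction i, hi using Nat.le_induction with
  | base => rw [bumpPath_self]; exact Nat.one_pos
  | succ i hi ih =>
    rw [bumpPath, if_neg (by omega), if_neg ih.ne']
    omega

theorem bumpPath_step {i r : ℕ} (hr : bumpPath a x i = r + 1) :
    (bumpPath a x (i + 1) = r + 1 ∧ a r (i + 1) ≤ a r i) ∨
      (bumpPath a x (i + 1) = r + 2 ∧ a r i < a r (i + 1)) := by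
  have hi : x < i := by
    by_contra hh
    rw [bumpPath_of_le (not_lt.mp hh)] at hr
    omega
  rw [bumpPath, if_neg (by omega), if_neg (by omega), hr, Nat.add_sub_cancel]
  split_ifs with hlt
  · exact Or.inr ⟨rfl, hlt⟩
  · exact Or.inl ⟨rfl, not_lt.mp hlt⟩

theorem bumpPath_cases (i : ℕ) :
    (bumpPath a x i = 0 ∧ bumpPath a x (i + 1) = 0) ∨
    (bumpPath a x i = 0 ∧ bumpPath a x (i + 1) = 1) ∨
    ∃ r, bumpPath a x i = r + 1 ∧ ((bumpPath a x (i + 1) = r + 1 ∧ a r (i + 1) ≤ a r i) ∨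
      (bumpPath a x (i + 1) = r + 2 ∧ a r i < a r (i + 1))) := by
  rcases lt_trichotomy i x with hi | rfl | hi
  · exact Or.inl ⟨bumpPath_of_le hi.le, bumpPath_of_le hi⟩
  · exact Or.inr (Or.inl ⟨bumpPath_of_le le_rfl, bumpPath_self⟩)
  · obtain ⟨r, hr⟩ := Nat.exists_eq_succ_of_ne_zero (bumpPath_pos (a := a) hi).ne'
    exact Or.inr (Or.inr ⟨r, hr, bumpPath_step hr⟩)

theorem bumpPath_le (i : ℕ) : bumpPath a x i ≤ i := by
  induction i with
  | zero => rfl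
  | succ i ih =>
    rcases bumpPath_cases (a := a) (x := x) i with h | h | ⟨r, h, h'⟩ <;> omega

theorem bumpPath_stable {N : ℕ} (hx : x < N) (ha : ∀ r, ∀ i ≥ N, a r i = a r N) {i : ℕ}
    (hi : N ≤ i) : bumpPath a x i = bumpPath a x N := by
  induction i, hi using Nat.le_induction with
  | base => rfl
  | succ i hi ih =>
    rw [← ih]
    obtain ⟨r, hr⟩ := Nat.exists_eq_succ_of_ne_zero (bumpPath_pos (a := a) (hx.trans_le hi)).ne'
    have h1 := ha r i hi
    have h2 := ha r (i + 1) (by omega)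
    rcases bumpPath_step hr with h | h <;> omega

/-- The new cell extends a partition to a partition. -/
theorem bumpPath_corner (ha : IsPattern a) {i r : ℕ} (hr : bumpPath a x i = r + 2) :
    a (r + 1) i < a r i := by
  induction i generalizing r with
  | zero => simp [bumpPath] at hr
  | succ i ih =>
    rcases bumpPath_cases (a := a) (x := x) i with h | h | ⟨s, h, h' | h'⟩
    · omega
    · omega
    · obtain rfl : s = r + 1 := by omega
      have := ih h
      have := ha.le_succ r i
      omega
    · obtain rfl : s = r := by omega
      have := ha.interlace s i
      omega

theorem IsPattern.rowInsert (ha : IsPattern a) (x : ℕ) : IsPattern (rowInsert a x) := by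
  refine ⟨fun r => ?_, fun r i => ?_, fun r i => ?_⟩
  · simp [BinomialEulerian.rowInsert, ha.zero, bumpPath]
  · have h0 := ha.le_succ r i
    unfold BinomialEulerian.rowInsert
    rcases bumpPath_cases (a := a) (x := x) i with h | h | ⟨s, h, h'⟩
    · split_ifs <;> omega
    · split_ifs <;> omega
    · by_cases hs : s = r
      · subst hs
        split_ifs <;> omega
      · split_ifs <;> omega
  · have h0 := ha.interlace r i
    unfold BinomialEulerian.rowInsert
    rcases bumpPath_cases (a := a) (x := x) i with h | h | ⟨s, h, h'⟩
    · split_ifs <;> omega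
    · split_ifs <;> omega
    · by_cases hs : s = r + 1
      · subst hs
        have := bumpPath_corner ha h
        split_ifs <;> omega
      · split_ifs <;> omega

theorem sum_rowInsert (i : ℕ) :
    ∑ r ∈ range i, rowInsert a x r i = ∑ r ∈ range i, a r i + if x < i then 1 else 0 := by
  unfold rowInsert
  rw [sum_add_distrib]
  congr 1
  split_ifs with hi
  · have h1 := bumpPath_pos (a := a) hi
    have h2 := bumpPath_le (a := a) (x := x) i
    rw [sum_eq_single (bumpPath a x i - 1)]
    · rw [if_pos (by omega)]
    · intro r _ hr
      rw [if_neg (by omega)]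
    · intro hh
      rw [mem_range] at hh
      omega
  · refine sum_eq_zero fun r _ => ?_
    rw [bumpPath_of_le (not_lt.mp hi), if_neg (by omega)]

/-! ### Reversing row insertion. -/

/-- The step backwards along a bumping path, in terms of the tableau after the insertion. -/
def backStep (b : ℕ → ℕ → ℕ) (i s : ℕ) : ℕ :=
  if s = 0 then 0 else if b (s - 1) i < b (s - 1) (i + 1) then s - 1 else s

/-- After insertion, the row of the new cell contains the letter `i` exactly when the path entered
that row at this step: a path that stays put requires a row without `i`. -/
theorem bumpPath_eq_backStep (ha : IsPattern a) (x i : ℕ) :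
    bumpPath a x i = backStep (rowInsert a x) i (bumpPath a x (i + 1)) := by
  unfold backStep rowInsert
  rcases bumpPath_cases (a := a) (x := x) i with h | h | ⟨s, h, h' | h'⟩
  · simp [h]
  · have := ha.le_succ 0 i
    simp only [h]
    simp
    omega
  · simp only [h, h']
    simp
    omega
  · have := ha.le_succ (s + 1) i
    simp only [h, h']
    simp
    omega

/-- The final row and the resulting tableau determine the whole path backwards. The path gives `a`
by subtraction and `x` as the place where it leaves 0. -/
theorem rowInsert_injective {a' : ℕ → ℕ → ℕ} {x' N : ℕ} (ha : IsPattern a) (ha' : IsPattern a')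
    (hins : rowInsert a x = rowInsert a' x')
    (hN : ∀ i ≥ N, bumpPath a x i = bumpPath a' x' i) : a = a' ∧ x = x' := by
  have hpath : ∀ i, bumpPath a x i = bumpPath a' x' i := by
    intro i
    by_cases hi : N ≤ i
    · exact hN i hi
    · refine Nat.decreasingInduction (motive := fun i _ => bumpPath a x i = bumpPath a' x' i)
        (fun j _ ih => ?_) (hN N le_rfl) (not_le.mp hi).le
      rw [bumpPath_eq_backStep ha, bumpPath_eq_backStep ha', hins, ih]
  constructor
  · funext r i
    have := congrFun (congrFun hins r) i
    unfold rowInsert at this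
    rw [hpath i] at this
    exact Nat.add_right_cancel this
  · have h1 := hpath (x + 1)
    have h2 := hpath (x' + 1)
    rw [bumpPath_self] at h1 h2
    rcases lt_trichotomy x x' with h | h | h
    · rw [bumpPath_of_le (by omega)] at h1
      omega
    · exact h
    · rw [bumpPath_of_le (by omega)] at h2
      omega

theorem exists_backPath (b : ℕ → ℕ → ℕ) {N s : ℕ} (hb : ∀ r, ∀ i ≥ N, b r i = b r N) :
    ∃ σ : ℕ → ℕ, (∀ i, σ i = backStep b i (σ (i + 1))) ∧ ∀ i ≥ N, σ i = s := by
  let σ' : ℕ → ℕ := fun k => Nat.rec s (fun k v => backStep b (N - (k + 1)) v) k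
  have h0 : σ' 0 = s := rfl
  have hs : ∀ k, σ' (k + 1) = backStep b (N - (k + 1)) (σ' k) := fun _ => rfl
  refine ⟨fun i => σ' (N - i), fun i => ?_, fun i hi => ?_⟩
  · simp only
    by_cases hi : i < N
    · rw [show N - i = (N - (i + 1)) + 1 by omega, hs,
        show N - (N - (i + 1) + 1) = i by omega]
    -- From `N` on the rows of `b` are constant, so a backward step changes nothing.
    · rw [show N - i = 0 by omega, show N - (i + 1) = 0 by omega, h0, backStep,
        hb _ i (by omega), hb _ (i + 1) (by omega)]
      simp
  · simp only
    rw [show N - i = 0 by omega, h0]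

/-- Reverse bumping from row `r`, whose last cell is a removable corner by `hr`. The invariant
`hcorner` keeps the cell to be removed a corner at every level. -/
theorem exists_rowInsert_eq {b : ℕ → ℕ → ℕ} (hb : IsPattern b) {N r : ℕ}
    (hN : ∀ s, ∀ i ≥ N, b s i = b s N) (hr : b (r + 1) N < b r N) :
    ∃ a x, IsPattern a ∧ rowInsert a x = b ∧ ∀ i ≥ N, bumpPath a x i = r + 1 := by
  obtain ⟨σ, hσ, hσN⟩ := exists_backPath b (s := r + 1) hN
  have hcases : ∀ i, (σ i = 0 ∧ σ (i + 1) = 0) ∨ ∃ s, σ (i + 1) = s + 1 ∧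
      ((σ i = s ∧ b s i < b s (i + 1)) ∨ (σ i = s + 1 ∧ b s i = b s (i + 1))) := by
    intro i
    have h1 := hσ i
    unfold backStep at h1
    rcases Nat.eq_zero_or_eq_succ_pred (σ (i + 1)) with h2 | h2
    · rw [if_pos h2] at h1
      exact Or.inl ⟨h1, h2⟩
    · right
      generalize (σ (i + 1)).pred = s at h2
      refine ⟨s, h2, ?_⟩
      rw [if_neg (by omega), h2, Nat.succ_sub_one] at h1
      have := hb.le_succ s i
      split_ifs at h1 with h3
      · exact Or.inl ⟨h1, h3⟩
      · exact Or.inr ⟨h1, by omega⟩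
  have hcorner : ∀ i s, σ i = s + 1 → b (s + 1) i < b s i := by
    intro i
    by_cases hi : N ≤ i
    · intro s hs
      rw [hσN i hi] at hs
      obtain rfl : s = r := by omega
      rwa [hN _ i hi, hN _ i hi]
    · refine Nat.decreasingInduction (motive := fun i _ => ∀ s, σ i = s + 1 → b (s + 1) i < b s i)
        (fun j _ ih => ?_) ?_ (not_le.mp hi).le
      · intro s hs
        rcases hcases j with h | ⟨u, hu, h | h⟩
        · omega
        · obtain rfl : u = s + 1 := by omega
          have := hb.interlace s j
          omega
        · obtain rfl : u = s := by omega
          have := ih _ hu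
          have := hb.le_succ (u + 1) j
          omega
      · intro s hs
        rw [hσN N le_rfl] at hs
        obtain rfl : s = r := by omega
        exact hr
  -- A nonzero value would be a corner of the empty tableau. The inserted letter `x` is then found
  -- just before the first nonzero value of `σ`.
  have hzero : σ 0 = 0 := by
    by_contra hne
    obtain ⟨s, hs⟩ := Nat.exists_eq_succ_of_ne_zero hne
    have := hcorner 0 s hs
    rw [hb.zero s] at this
    omega
  have hex : ∃ i, σ i ≠ 0 := ⟨N, by rw [hσN N le_rfl]; omega⟩
  classical
  obtain ⟨x, hx⟩ : ∃ x, Nat.find hex = x + 1 := by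
    refine Nat.exists_eq_succ_of_ne_zero fun h => ?_
    have := Nat.find_spec hex
    rw [h] at this
    exact this hzero
  have hbelow : ∀ i ≤ x, σ i = 0 := fun i hi => by
    by_contra hne
    have := Nat.find_min' hex hne
    omega
  have habove : σ (x + 1) ≠ 0 := hx ▸ Nat.find_spec hex
  set a : ℕ → ℕ → ℕ := fun s i => b s i - if σ i = s + 1 then 1 else 0 with ha
  have hab : ∀ s i, a s i + (if σ i = s + 1 then 1 else 0) = b s i := by
    intro s i
    simp only [ha]
    split_ifs with h
    · have := hcorner i s h
      omega
    · rfl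
  have hpath : ∀ i, bumpPath a x i = σ i := by
    intro i
    induction i with
    | zero => rw [hzero]; rfl
    | succ i ih =>
      rcases lt_trichotomy i x with hi | rfl | hi
      · rw [bumpPath_of_le (by omega), hbelow _ (by omega)]
      · rw [bumpPath_self]
        have := hbelow i le_rfl
        rcases hcases i with h | ⟨s, h1, h2⟩ <;> omega
      · obtain ⟨s, hs⟩ := Nat.exists_eq_succ_of_ne_zero (bumpPath_pos (a := a) hi).ne'
        have h1 := hab s i
        have h2 := hab s (i + 1)
        rw [if_pos (by omega)] at h1
        have h3 := hb.le_succ s i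
        rcases hcases i with h | ⟨u, hu, h | h⟩
        · omega
        · obtain rfl : u = s + 1 := by omega
          rw [if_neg (by omega)] at h2
          rcases bumpPath_step hs with h' | h' <;> omega
        · obtain rfl : u = s := by omega
          rw [if_pos (by omega)] at h2
          rcases bumpPath_step hs with h' | h' <;> omega
  refine ⟨a, x, ⟨fun s => ?_, fun s i => ?_, fun s i => ?_⟩, ?_, fun i hi => ?_⟩
  · simp [ha, hb.zero]
  · have h1 := hab s i
    have h2 := hab s (i + 1)
    have h3 := hb.le_succ s i
    rcases hcases i with h | ⟨u, hu, h | h⟩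
    · split_ifs at h1 h2 <;> omega
    · by_cases hus : u = s
      · subst hus
        split_ifs at h1 h2 <;> omega
      · split_ifs at h1 h2 <;> omega
    · split_ifs at h1 h2 <;> omega
  · have h1 := hab s i
    have h2 := hab (s + 1) (i + 1)
    have h3 := hb.interlace s i
    rcases hcases i with h | ⟨u, hu, h | h⟩
    · split_ifs at h1 h2 <;> omega
    · split_ifs at h1 h2 <;> omega
    · by_cases hus : u = s
      · subst hus
        have := hcorner _ _ hu
        split_ifs at h1 h2 <;> omega
      · split_ifs at h1 h2 <;> omega
  · funext s i
    rw [rowInsert, hpath, hab]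
  · rw [hpath, hσN i hi]

/-- The row bumping lemma for a weak ascent. -/
theorem bumpPath_le_of_le {y : ℕ} (hxy : x ≤ y) {i : ℕ} (hi : y < i) :
    bumpPath (rowInsert a x) y i ≤ bumpPath a x i := by
  induction i, hi using Nat.le_induction with
  | base =>
    rw [bumpPath_self]
    exact bumpPath_pos (by omega)
  | succ i hi ih =>
    obtain ⟨r, hr⟩ := Nat.exists_eq_succ_of_ne_zero
      (bumpPath_pos (a := a) (show x < i by omega)).ne'
    obtain ⟨s, hs⟩ := Nat.exists_eq_succ_of_ne_zero (bumpPath_pos (a := rowInsert a x) hi).ne'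
    have h1 := bumpPath_step hr
    have h2 := bumpPath_step hs
    by_cases hrs : s = r
    · subst hrs
      simp only [rowInsert] at h2
      rcases h1 with h1 | h1
      · rw [if_pos h1.1, if_pos hr] at h2
        omega
      · omega
    · omega

/-- The row bumping lemma for a strict descent. -/
theorem bumpPath_lt_of_lt (ha : IsPattern a) {y : ℕ} (hxy : y < x) {i : ℕ} (hi : x < i) :
    bumpPath a x i < bumpPath (rowInsert a x) y i := by
  induction i, hi using Nat.le_induction with
  | base =>
    change bumpPath a x (x + 1) < bumpPath (rowInsert a x) y (x + 1)
    rw [bumpPath_self]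
    obtain ⟨s, hs⟩ := Nat.exists_eq_succ_of_ne_zero (bumpPath_pos (a := rowInsert a x) hxy).ne'
    have h2 := bumpPath_step hs
    by_cases hs0 : s = 0
    · subst hs0
      simp only [rowInsert, bumpPath_self, bumpPath_of_le (le_refl x)] at h2
      have := ha.le_succ 0 x
      simp at h2
      omega
    · omega
  | succ i hi ih =>
    obtain ⟨r, hr⟩ := Nat.exists_eq_succ_of_ne_zero (bumpPath_pos (a := a) hi).ne'
    obtain ⟨s, hs⟩ := Nat.exists_eq_succ_of_ne_zero
      (bumpPath_pos (a := rowInsert a x) (show y < i by omega)).ne'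
    have h1 := bumpPath_step hr
    have h2 := bumpPath_step hs
    by_cases hrs : s = r + 1
    · subst hrs
      simp only [rowInsert] at h2
      rcases h1 with h1 | h1
      · omega
      · rw [if_pos h1.1, if_neg (by omega)] at h2
        have := ha.le_succ (r + 1) i
        omega
    · omega

end

/-! ### The Robinson–Schensted–Knuth correspondence for words -/

/-- A number larger than all letters of the word. -/
def letterBound : List ℕ → ℕ
  | [] => 0
  | x :: l => max (letterBound l) (x + 1)

/-- The insertion tableau of a word whose letters are inserted from the right to the left. -/
def insertionTableau : List ℕ → ℕ → ℕ → ℕ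
  | [] => fun _ _ => 0
  | x :: l => rowInsert (insertionTableau l) x

/-- The recording tableau, given by the list of rows in which a cell is added. -/
def recording : List ℕ → List ℕ
  | [] => []
  | x :: l => (bumpPath (insertionTableau l) x (letterBound (x :: l)) - 1) :: recording l

theorem isPattern_insertionTableau (l : List ℕ) : IsPattern (insertionTableau l) := by
  induction l with
  | nil => exact ⟨fun _ => rfl, fun _ _ => le_rfl, fun _ _ => le_rfl⟩
  | cons x l ih => exact ih.rowInsert x

/-- Insertion and recording tableaux have the same shape; beyond `letterBound` the bumping paths are
stationary. -/
theorem insertionTableau_eq_count {l : List ℕ} :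
    ∀ i ≥ letterBound l, ∀ r, insertionTableau l r i = (recording l).count r := by
  induction l with
  | nil => simp [insertionTableau, recording]
  | cons x l ih =>
    intro i hi r
    have hle : letterBound l ≤ letterBound (x :: l) := le_max_left _ _
    have hx : x < letterBound (x :: l) := Nat.lt_of_succ_le (le_max_right _ _)
    have hst : ∀ r, ∀ i ≥ letterBound (x :: l),
        insertionTableau l r i = insertionTableau l r (letterBound (x :: l)) := fun r i hi => by
      rw [ih i (hle.trans hi), ih _ hle]
    have hpos := bumpPath_pos (a := insertionTableau l) hx
    rw [insertionTableau, rowInsert, ih i (hle.trans hi), bumpPath_stable hx hst hi, recording,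
      List.count_cons]
    congr 1
    simp only [beq_iff_eq]
    refine if_congr ?_ rfl rfl
    omega

theorem bumpPath_insertionTableau {x : ℕ} {l : List ℕ} {i : ℕ} (hi : letterBound (x :: l) ≤ i) :
    bumpPath (insertionTableau l) x i = (recording (x :: l)).getD 0 0 + 1 := by
  have hle : letterBound l ≤ letterBound (x :: l) := le_max_left _ _
  have hx : x < letterBound (x :: l) := Nat.lt_of_succ_le (le_max_right _ _)
  have hst : ∀ r, ∀ i ≥ letterBound (x :: l),
      insertionTableau l r i = insertionTableau l r (letterBound (x :: l)) := fun r i hi => by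
    rw [insertionTableau_eq_count i (hle.trans hi), insertionTableau_eq_count _ hle]
  have hpos := bumpPath_pos (a := insertionTableau l) hx
  rw [bumpPath_stable hx hst hi, recording, List.getD_cons_zero]
  omega

theorem length_recording (l : List ℕ) : (recording l).length = l.length := by
  induction l with
  | nil => rfl
  | cons x l ih => rw [recording, List.length_cons, List.length_cons, ih]

theorem antitone_count_recording (l : List ℕ) : Antitone fun r => (recording l).count r := by
  simp only [← insertionTableau_eq_count (letterBound l) le_rfl]
  exact (isPattern_insertionTableau l).antitone _

theorem lt_length_of_mem_recording {l : List ℕ} {r : ℕ} (hr : r ∈ recording l) : r < l.length := by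
  have hsub : range (r + 1) ⊆ (recording l).toFinset := by
    intro s hs
    have h1 := antitone_count_recording l (Nat.lt_succ_iff.mp (mem_range.mp hs))
    have h2 := List.count_pos_iff.mpr hr
    exact List.mem_toFinset.mpr (List.count_pos_iff.mp (h2.trans_le h1))
  have := (card_le_card hsub).trans (List.toFinset_card_le _)
  rw [card_range, length_recording] at this
  exact this

/-- The analogue of `ascSet` for recording tableaux. -/
def descSet (l : List ℕ) : Finset ℕ :=
  (range (l.length - 1)).filter fun i => l.getD (i + 1) 0 < l.getD i 0

theorem mem_descSet {l : List ℕ} {i : ℕ} :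
    i ∈ descSet l ↔ i + 1 < l.length ∧ l.getD (i + 1) 0 < l.getD i 0 := by
  simp only [descSet, mem_filter, mem_range]
  omega

/-- As `x :: y :: l` inserts `y` before `x`, the two row bumping lemmas say that the cell of `x` is
strictly below that of `y` exactly when `x < y`. -/
theorem descSet_recording (l : List ℕ) : descSet (recording l) = ascSet l := by
  induction l with
  | nil => rfl
  | cons x l ih =>
    ext i
    rcases i with _ | i
    · rcases l with _ | ⟨y, l⟩
      · simp [mem_descSet, mem_ascSet, recording]
      · have h1 : letterBound (y :: l) ≤ letterBound (x :: y :: l) := le_max_left _ _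
        have hx : x < letterBound (x :: y :: l) := Nat.lt_of_succ_le (le_max_right _ _)
        have hy : y < letterBound (x :: y :: l) :=
          (Nat.lt_of_succ_le (le_max_right _ _)).trans_le h1
        have h2 := bumpPath_insertionTableau (x := y) (l := l) h1
        have h3 := bumpPath_insertionTableau (x := x) (l := y :: l) le_rfl
        rw [insertionTableau] at h3
        have h4 := fun h => bumpPath_le_of_le (a := insertionTableau l) (x := y) (y := x) h hx
        have h5 := fun h =>
          bumpPath_lt_of_lt (isPattern_insertionTableau l) (x := y) (y := x) h hy
        rw [h2, h3] at h4 h5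
        have h6 : (recording (x :: y :: l)).getD 1 0 = (recording (y :: l)).getD 0 0 := by
          rw [recording, List.getD_cons_succ]
        rw [mem_descSet, mem_ascSet, length_recording, zero_add, h6]
        simp only [List.getD_cons_zero, List.getD_cons_succ]
        refine and_congr_right fun _ => ⟨fun h => ?_, fun h => ?_⟩
        · by_contra hh
          have := h4 (not_lt.mp hh)
          omega
        · have := h5 h
          omega
    · rw [succ_mem_ascSet_cons, ← ih, mem_descSet, mem_descSet, recording]
      simp

theorem insertionTableau_injective {l l' : List ℕ} (hrec : recording l = recording l')
    (hins : insertionTableau l = insertionTableau l') : l = l' := by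
  induction l generalizing l' with
  | nil =>
    have := congrArg List.length hrec
    rw [length_recording, length_recording] at this
    exact (List.length_eq_zero_iff.mp this.symm).symm
  | cons x l ih =>
    rcases l' with _ | ⟨x', l'⟩
    · simp [recording] at hrec
    · have hrec' : recording l = recording l' := by
        have := congrArg List.tail hrec
        simpa only [recording, List.tail_cons] using this
      obtain ⟨h1, rfl⟩ := rowInsert_injective (isPattern_insertionTableau l)
        (isPattern_insertionTableau l')
        (N := max (letterBound (x :: l)) (letterBound (x' :: l'))) hins fun i hi => by
          rw [bumpPath_insertionTableau ((le_max_left _ _).trans hi),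
            bumpPath_insertionTableau ((le_max_right _ _).trans hi), hrec]
      rw [ih hrec' h1]

theorem exists_insertionTableau_eq (l : List ℕ) {b : ℕ → ℕ → ℕ} (hb : IsPattern b) {N : ℕ}
    (hN : ∀ i ≥ N, ∀ r, b r i = (recording l).count r) :
    ∃ l', recording l' = recording l ∧ insertionTableau l' = b := by
  induction l generalizing b N with
  | nil =>
    refine ⟨[], rfl, ?_⟩
    funext r i
    have h1 := hb.mono r (le_max_left i N)
    rw [hN _ (le_max_right _ _)] at h1
    simp only [recording, List.count_nil, nonpos_iff_eq_zero] at h1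
    exact h1.symm
  | cons x l ih =>
    obtain ⟨r, hr⟩ : ∃ r, recording (x :: l) = r :: recording l := ⟨_, rfl⟩
    rw [hr] at hN ⊢
    -- The row counts of `recording l` form a partition, so the extra cell in row `r` is a corner.
    have hcorner : b (r + 1) N < b r N := by
      rw [hN N le_rfl, hN N le_rfl, List.count_cons_self, List.count_cons_of_ne (by omega)]
      exact Nat.lt_succ_of_le (antitone_count_recording l (Nat.le_succ r))
    obtain ⟨a, y, ha, hab, hpath⟩ := exists_rowInsert_eq hb
      (fun s i hi => (hN i hi s).trans (hN N le_rfl s).symm) hcorner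
    have haN : ∀ i ≥ N, ∀ s, a s i = (recording l).count s := by
      intro i hi s
      have h1 := congrFun (congrFun hab s) i
      rw [rowInsert, hpath i hi, hN i hi, List.count_cons] at h1
      simp only [Nat.add_right_cancel_iff, beq_iff_eq] at h1
      exact h1
    obtain ⟨l', h1, h2⟩ := ih ha haN
    refine ⟨y :: l', ?_, ?_⟩
    · have h3 := bumpPath_insertionTableau (x := y) (l := l')
        (le_max_left (letterBound (y :: l')) N)
      rw [h2, hpath _ (le_max_right _ _), recording, List.getD_cons_zero] at h3
      rw [recording, h1]
      congr 1
      omega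
    · rw [insertionTableau, h2, hab]

theorem sum_insertionTableau (l : List ℕ) (i : ℕ) :
    ∑ r ∈ range i, insertionTableau l r i = ∑ j ∈ range i, wordContent l j := by
  induction l with
  | nil => simp [insertionTableau, wordContent]
  | cons x l ih =>
    rw [insertionTableau, sum_rowInsert, ih]
    have : wordContent (x :: l) = wordContent l + Finsupp.single x 1 := by
      rw [wordContent, wordContent, ← Multiset.cons_coe, ← Multiset.singleton_add, map_add,
        Multiset.toFinsupp_singleton, add_comm]
    rw [this]
    simp only [Finsupp.add_apply, sum_add_distrib, Finsupp.single_apply, sum_ite_eq, mem_range]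

theorem eq_of_sum_range_eq {f g : ℕ → ℕ} (hfg : ∀ i, ∑ j ∈ range i, f j = ∑ j ∈ range i, g j) :
    f = g := by
  funext i
  have h1 := hfg i
  have h2 := hfg (i + 1)
  rw [sum_range_succ, sum_range_succ, h1] at h2
  exact Nat.add_left_cancel h2

/-! ### Tableaux of straight shape as patterns -/

/-- The patterns with given row lengths and content. -/
def patterns (f : ℕ → ℕ) (m : ℕ →₀ ℕ) : Set (ℕ → ℕ → ℕ) :=
  {a | IsPattern a ∧ (∃ N, ∀ i ≥ N, ∀ r, a r i = f r) ∧
    ∀ i, ∑ r ∈ range i, a r i = ∑ j ∈ range i, m j}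

/-- RSK with the recording tableau fixed: only the shape of that tableau remains on the right. -/
theorem card_recording_eq (l : List ℕ) (m : ℕ →₀ ℕ) :
    Nat.card {l' // recording l' = recording l ∧ wordContent l' = m} =
      Nat.card (patterns (fun r => (recording l).count r) m) := by
  refine Nat.card_congr (Equiv.ofBijective (fun l' => ⟨insertionTableau l'.1, ?_⟩) ⟨?_, ?_⟩)
  · refine ⟨isPattern_insertionTableau _, ⟨letterBound l'.1, ?_⟩, ?_⟩
    · intro i hi r
      rw [insertionTableau_eq_count i hi, l'.2.1]
    · intro i
      rw [sum_insertionTableau, l'.2.2]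
  · rintro ⟨l₁, h1, h1'⟩ ⟨l₂, h2, h2'⟩ e
    exact Subtype.ext (insertionTableau_injective (h1.trans h2.symm) (congrArg Subtype.val e))
  · rintro ⟨b, hb, ⟨N, hN⟩, hm⟩
    obtain ⟨l', h1, rfl⟩ := exists_insertionTableau_eq l hb hN
    refine ⟨⟨l', h1, DFunLike.coe_injective (eq_of_sum_range_eq fun i => ?_)⟩, rfl⟩
    rw [← sum_insertionTableau, hm]

section

variable {μ : YoungDiagram}

/-- The pattern of a tableau of straight shape. -/
noncomputable def SkewTableau.pattern (T : SkewTableau μ.cells) (r i : ℕ) : ℕ :=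
  (univ.filter fun x : μ.cells => x.1.1 = r ∧ T.entry x < i).card

theorem SkewTableau.pattern_eq (T : SkewTableau μ.cells) (r i : ℕ) : T.pattern r i =
    ((range (μ.rowLen r)).filter fun c => ∃ h : (r, c) ∈ μ.cells, T.entry ⟨(r, c), h⟩ < i).card := by
  refine card_bij (fun x _ => x.1.2) ?_ ?_ ?_
  · rintro ⟨⟨r', c⟩, hx⟩ h
    simp only [mem_filter, mem_univ, true_and] at h
    obtain ⟨rfl, h⟩ := h
    exact mem_filter.mpr ⟨mem_range.mpr (YoungDiagram.mem_iff_lt_rowLen.mp hx), hx, h⟩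
  · rintro ⟨⟨r₁, c₁⟩, h₁⟩ e₁ ⟨⟨r₂, c₂⟩, h₂⟩ e₂ e
    simp only [mem_filter, mem_univ, true_and] at e₁ e₂ e
    obtain ⟨rfl, -⟩ := e₁
    obtain ⟨rfl, -⟩ := e₂
    simp only [e]
  · intro c hc
    obtain ⟨-, hx, h⟩ := mem_filter.mp hc
    exact ⟨⟨(r, c), hx⟩, mem_filter.mpr ⟨mem_univ _, rfl, h⟩, rfl⟩

theorem SkewTableau.lt_pattern_iff (T : SkewTableau μ.cells) {r c : ℕ} (hx : (r, c) ∈ μ.cells)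
    (i : ℕ) : c < T.pattern r i ↔ T.entry ⟨(r, c), hx⟩ < i := by
  rw [T.pattern_eq]
  constructor
  · intro hlt
    by_contra hh
    have : (range (μ.rowLen r)).filter
        (fun c => ∃ h : (r, c) ∈ μ.cells, T.entry ⟨(r, c), h⟩ < i) ⊆ range c := by
      intro d hd
      obtain ⟨-, hd, hd'⟩ := mem_filter.mp hd
      rw [mem_range]
      by_contra hdc
      exact hh ((T.row_weak ⟨(r, c), hx⟩ ⟨(r, d), hd⟩ rfl (not_lt.mp hdc)).trans_lt hd')
    have := card_le_card this
    rw [card_range] at this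
    omega
  · intro hlt
    have : range (c + 1) ⊆ (range (μ.rowLen r)).filter
        (fun c => ∃ h : (r, c) ∈ μ.cells, T.entry ⟨(r, c), h⟩ < i) := by
      intro d hd
      have hd := mem_range.mp hd
      have hd' : (r, d) ∈ μ.cells := μ.up_left_mem le_rfl (Nat.lt_succ_iff.mp hd) hx
      exact mem_filter.mpr ⟨mem_range.mpr (YoungDiagram.mem_iff_lt_rowLen.mp hd'), hd',
        (T.row_weak ⟨(r, d), hd'⟩ ⟨(r, c), hx⟩ rfl (Nat.lt_succ_iff.mp hd)).trans_lt hlt⟩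
    have := card_le_card this
    rw [card_range] at this
    omega

theorem SkewTableau.pattern_le (T : SkewTableau μ.cells) (r i : ℕ) : T.pattern r i ≤ μ.rowLen r := by
  rw [T.pattern_eq]
  exact (card_filter_le _ _).trans (card_range _).le

theorem SkewTableau.isPattern_pattern (T : SkewTableau μ.cells) : IsPattern T.pattern := by
  refine ⟨fun r => by simp [SkewTableau.pattern], fun r i => card_le_card ?_, fun r i => ?_⟩
  · intro x hx
    simp only [mem_filter, mem_univ, true_and] at hx ⊢
    omega
  · refine le_of_forall_lt fun c hc => ?_
    have hx : (r + 1, c) ∈ μ.cells :=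
      YoungDiagram.mem_iff_lt_rowLen.mpr (hc.trans_le (T.pattern_le _ _))
    have hx' : (r, c) ∈ μ.cells := μ.up_left_mem (Nat.le_succ r) le_rfl hx
    rw [T.lt_pattern_iff hx] at hc
    rw [T.lt_pattern_iff hx']
    have := T.col_strict ⟨(r, c), hx'⟩ ⟨(r + 1, c), hx⟩ rfl (Nat.lt_succ_self r)
    omega

/-- Column strictness. It confines the letters less than `i` to the first `i` rows, which justifies
the finite sums over `range i` in `patterns`. -/
theorem SkewTableau.le_row (T : SkewTableau μ.cells) {r c : ℕ} (hx : (r, c) ∈ μ.cells) :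
    r ≤ T.entry ⟨(r, c), hx⟩ := by
  induction r with
  | zero => exact Nat.zero_le _
  | succ r ih =>
    have hx' : (r, c) ∈ μ.cells := μ.up_left_mem (Nat.le_succ r) le_rfl hx
    have h1 := ih hx'
    have h2 := T.col_strict ⟨(r, c), hx'⟩ ⟨(r + 1, c), hx⟩ rfl (Nat.lt_succ_self r)
    omega

theorem SkewTableau.sum_pattern (T : SkewTableau μ.cells) (i : ℕ) :
    ∑ r ∈ range i, T.pattern r i = ∑ j ∈ range i, T.content j := by
  have h1 : ∑ r ∈ range i, T.pattern r i = (univ.filter fun x => T.entry x < i).card := by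
    rw [card_eq_sum_card_fiberwise (f := fun x => x.1.1) (t := range i)]
    · refine sum_congr rfl fun r _ => ?_
      rw [SkewTableau.pattern, filter_filter]
      simp only [and_comm]
    · rintro ⟨⟨r, c⟩, hx⟩ h
      simp only [coe_filter, mem_univ, true_and, Set.mem_ofPred_eq] at h
      have := T.le_row hx
      simp only [coe_range, Set.mem_Iio]
      omega
  rw [h1, card_filter]
  simp only [SkewTableau.content, Finsupp.finsetSum_apply]
  rw [sum_comm]
  refine sum_congr rfl fun x _ => ?_
  simp only [Finsupp.single_apply, sum_ite_eq, mem_range]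

theorem SkewTableau.exists_pattern_eq {a : ℕ → ℕ → ℕ} (ha : IsPattern a)
    (hN : ∃ N, ∀ i ≥ N, ∀ r, a r i = μ.rowLen r) : ∃ T : SkewTableau μ.cells, T.pattern = a := by
  classical
  obtain ⟨N, hN⟩ := hN
  have hle : ∀ r i, a r i ≤ μ.rowLen r := fun r i =>
    (ha.mono r (le_max_left i N)).trans (hN _ (le_max_right _ _) r).le
  -- The entry of a cell is the least `i` such that its row has enough letters at most `i` to reach
  -- its column.
  have hex : ∀ x : μ.cells, ∃ i, x.1.2 < a x.1.1 (i + 1) := fun x =>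
    ⟨N, by rw [hN _ (by omega)]; exact YoungDiagram.mem_iff_lt_rowLen.mp x.2⟩
  have hfind : ∀ (x : μ.cells) i, Nat.find (hex x) < i ↔ x.1.2 < a x.1.1 i := by
    intro x i
    rw [Nat.find_lt_iff]
    constructor
    · rintro ⟨j, hj, h⟩
      exact h.trans_le (ha.mono _ hj)
    · intro h
      rcases i with _ | i
      · rw [ha.zero] at h
        omega
      · exact ⟨i, Nat.lt_succ_self i, h⟩
  have hspec : ∀ x : μ.cells, x.1.2 < a x.1.1 (Nat.find (hex x) + 1) := fun x =>
    (hfind x _).mp (Nat.lt_succ_self _)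
  let T : SkewTableau μ.cells := ⟨fun x => Nat.find (hex x), ?_, ?_⟩
  · refine ⟨T, ?_⟩
    funext r i
    refine eq_of_forall_lt_iff fun c => ?_
    by_cases hc : c < μ.rowLen r
    · rw [T.lt_pattern_iff (YoungDiagram.mem_iff_lt_rowLen.mpr hc)]
      exact hfind _ i
    · have h1 := T.pattern_le r i
      have h2 := hle r i
      omega
  · intro x y h1 h2
    refine Nat.lt_succ_iff.mp ((hfind x _).mpr ?_)
    rw [h1]
    exact h2.trans_lt (hspec y)
  · intro x y h1 h2
    refine (hfind x _).mpr ?_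
    rw [h1]
    refine (hspec y).trans_le ?_
    exact (ha.antitone _ (Nat.succ_le_of_lt h2)).trans (ha.interlace _ _)

end

theorem card_tableaux_eq (μ : YoungDiagram) (m : ℕ →₀ ℕ) :
    Nat.card {T : SkewTableau μ.cells // T.content = m} = Nat.card (patterns μ.rowLen m) := by
  refine Nat.card_congr (Equiv.ofBijective (fun T => ⟨T.1.pattern, ?_⟩) ⟨?_, ?_⟩)
  · refine ⟨T.1.isPattern_pattern, ⟨univ.sup T.1.entry + 1, fun i hi r => ?_⟩, ?_⟩
    · refine eq_of_forall_lt_iff fun c => ?_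
      by_cases hc : c < μ.rowLen r
      · have hx : (r, c) ∈ μ.cells := YoungDiagram.mem_iff_lt_rowLen.mpr hc
        rw [T.1.lt_pattern_iff hx]
        have : T.1.entry ⟨(r, c), hx⟩ ≤ univ.sup T.1.entry := le_sup (mem_univ _)
        exact iff_of_true (by omega) hc
      · have := T.1.pattern_le r i
        omega
    · intro i
      rw [T.1.sum_pattern, T.2]
  · intro T T' e
    refine Subtype.ext (SkewTableau.ext' ?_)
    rintro ⟨⟨r, c⟩, hx⟩
    refine eq_of_forall_gt_iff fun i => ?_
    rw [← T.1.lt_pattern_iff hx, ← T'.1.lt_pattern_iff hx,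
      show T.1.pattern = T'.1.pattern from congrArg Subtype.val e]
  · rintro ⟨a, ha, hN, hm⟩
    obtain ⟨T, rfl⟩ := SkewTableau.exists_pattern_eq ha hN
    refine ⟨⟨T, DFunLike.coe_injective (eq_of_sum_range_eq fun i => ?_)⟩, rfl⟩
    rw [← T.sum_pattern, hm]

/-! ### Schur positivity -/

theorem exists_shape_recording (l : List ℕ) :
    ∃ μ : YoungDiagram, μ.rowLen = fun r => (recording l).count r := by
  let μ : YoungDiagram := ⟨((recording l).toFinset ×ˢ range (l.length)).filter
    fun x => x.2 < (recording l).count x.1, by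
      intro x y hyx hx
      simp only [coe_filter, mem_product, List.mem_toFinset, mem_range, Set.mem_ofPred_eq] at hx ⊢
      obtain ⟨⟨h1, h2⟩, h3⟩ := hx
      obtain ⟨h4, h5⟩ := Prod.le_def.mp hyx
      have h6 := antitone_count_recording l h4
      simp only at h6
      exact ⟨⟨List.count_pos_iff.mp (by omega), by omega⟩, by omega⟩⟩
  refine ⟨μ, funext fun r => eq_of_forall_lt_iff fun c => ?_⟩
  rw [← YoungDiagram.mem_iff_lt_rowLen, ← YoungDiagram.mem_cells]
  simp only [μ, mem_filter, mem_product, List.mem_toFinset, mem_range]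
  refine ⟨fun hh => hh.2, fun hh => ⟨⟨List.count_pos_iff.mp (by omega), ?_⟩, hh⟩⟩
  have := List.count_le_length (l := recording l) (a := r)
  rw [length_recording] at this
  omega

theorem isSchurPositive_zero : IsSchurPositive 0 := ⟨0, fun _ => le_rfl, by simp⟩

theorem isSchurPositive_schur (μ : YoungDiagram) : IsSchurPositive (schur μ) := by
  classical
  refine ⟨Finsupp.single μ 1, fun ν => ?_, by simp⟩
  rw [Finsupp.single_apply]
  split_ifs <;> norm_num

theorem IsSchurPositive.add {f g : Ser} (hf : IsSchurPositive f) (hg : IsSchurPositive g) :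
    IsSchurPositive (f + g) := by
  obtain ⟨c, hc, rfl⟩ := hf
  obtain ⟨d, hd, rfl⟩ := hg
  refine ⟨c + d, fun μ => add_nonneg (hc μ) (hd μ), ?_⟩
  rw [Finsupp.sum_add_index' (by simp) (by intros; rw [add_smul])]

theorem finite_recordings (n : ℕ) : {q | ∃ l : List ℕ, l.length = n ∧ recording l = q}.Finite := by
  refine (Set.finite_range fun f : Fin n → Fin n => List.ofFn fun i => (f i : ℕ)).subset ?_
  rintro q ⟨l, hl, rfl⟩
  have hlen : (recording l).length = n := (length_recording l).trans hl
  refine ⟨fun i => ⟨(recording l)[(i : ℕ)]'(by omega), ?_⟩, ?_⟩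
  · exact (lt_length_of_mem_recording (List.getElem_mem _)).trans_eq hl
  · refine List.ext_getElem (by simp [hlen]) fun j h1 h2 => ?_
    simp

/-- Words are grouped by recording tableau. Each class satisfies `P` as a whole, since the recording
determines the ascents, and contributes a single Schur function. -/
theorem isSchurPositive_wordSum (n : ℕ) (P : Finset ℕ → Prop) [DecidablePred P] :
    IsSchurPositive (wordSum n fun l => if P (ascSet l) then 1 else 0) := by
  classical
  choose shape hshape using exists_shape_recording
  have hfin : {q | ∃ l : List ℕ, (l.length = n ∧ P (ascSet l)) ∧ recording l = q}.Finite :=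
    (finite_recordings n).subset fun q ⟨l, h1, h2⟩ => ⟨l, h1.1, h2⟩
  have hword : ∀ q, ∃ l, q ∈ hfin.toFinset → (l.length = n ∧ P (ascSet l)) ∧ recording l = q := by
    intro q
    by_cases hq : q ∈ hfin.toFinset
    · obtain ⟨l, hl⟩ := hfin.mem_toFinset.mp hq
      exact ⟨l, fun _ => hl⟩
    · exact ⟨[], fun hh => absurd hh hq⟩
  choose word hword using hword
  have hsum : (wordSum n fun l => if P (ascSet l) then 1 else 0) =
      ∑ q ∈ hfin.toFinset, schur (shape (word q)) := by
    ext m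
    rw [coeff_wordSum, ← sum_filter, sum_const, nsmul_eq_mul, mul_one, filter_filter, map_sum,
      card_eq_sum_card_fiberwise (f := recording) (t := hfin.toFinset)]
    · rw [Nat.cast_sum]
      refine sum_congr rfl fun q hq => ?_
      change _ = (Nat.card {T : SkewTableau (shape (word q)).cells // T.content = m} : ℝ)
      obtain ⟨⟨h1, h2⟩, h3⟩ := hword q hq
      rw [card_tableaux_eq, hshape, ← card_recording_eq, ← Nat.card_eq_finsetCard]
      congr 1
      refine Nat.card_congr (Equiv.subtypeEquivRight fun l => ?_)
      simp only [mem_filter, mem_words]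
      constructor
      · rintro ⟨⟨h4, -⟩, h5⟩
        exact ⟨h5.trans h3.symm, h4⟩
      · rintro ⟨h4, h5⟩
        refine ⟨⟨h5, ?_, ?_⟩, h4.trans h3⟩
        · rw [← length_recording, h4, length_recording, h1]
        · rwa [← descSet_recording, h4, descSet_recording]
    · intro l hl
      simp only [coe_filter, Set.mem_ofPred_eq] at hl
      exact hfin.mem_toFinset.mpr ⟨l, hl.2, rfl⟩
  rw [hsum]
  exact sum_induction _ IsSchurPositive (fun _ _ => IsSchurPositive.add) isSchurPositive_zero
    fun q _ => isSchurPositive_schur _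

theorem isSchurPositive_gammaTilde (n k : ℕ) : IsSchurPositive (gammaTilde n k) := by
  rw [gammaTilde_eq_wordSum]
  exact isSchurPositive_wordSum n fun S => S ∈ ascSets n k

end BinomialEulerian

theorem theorem3p3 (n : ℕ) :
    (BinomialEulerian.QTilde n = ∑ k ∈ Finset.range (n / 2 + 1),
      Polynomial.C (BinomialEulerian.gammaTilde n k) * Polynomial.X ^ k *
        (1 + Polynomial.X) ^ (n - 2 * k)) ∧
    BinomialEulerian.IsSchurGammaPositive n (BinomialEulerian.QTilde n) :=
  ⟨BinomialEulerian.QTilde_eq_sum n, BinomialEulerian.gammaTilde n,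
    fun k _ => BinomialEulerian.isSchurPositive_gammaTilde n k, BinomialEulerian.QTilde_eq_sum n⟩
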